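/- Let $H$ be a complex Hilbert space and $\mathcal N\subset B(H)$ a von Neumann algebra with a faithful normal semifinite trace $\tau$. Let $K(\mathcal N)$ be the norm-closed two-sided ideal of $\mathcal N$ generated by the projections of finite trace, $Q(\mathcal N)=\mathcal N/K(\mathcal N)$, and $\pi:\mathcal N\to Q(\mathcal N)$ the quotient map. Let $AS(\mathcal N)$ be the set of (possibly unbounded) selfadjoint operators $D$ on $H$ affiliated to $\mathcal N$, i.e. whose bounded transform $F_D=D(1+D^2)^{-1/2}$ lies in $\mathcal N$, and let $ASF(\mathcal N)\subset AS(\mathcal N)$ be the set of Breuer-Fredholm operators, i.e. those $D$ with $\pi(F_D)$ invertible in $Q(\mathcal N)$. The gap topology on $AS(\mathcal N)$ is the weakest topology for which $D\mapsto (D+i)^{-1}\in\mathcal N$ is norm continuous; write $AS(\mathcal N)_{gap}$ for the resulting space. Let $\phi\in C_c^\infty(\mathbb R)$ be an even real-valued function with $\operatorname{supp}\phi=[-1,1]$ and $\phi'(x)>0$ for $x\in(-1,0)$, and put $\phi_n(x)=\phi(nx)$. For each integer $n\ge 1$ let $\psi_n:\mathbb R\to[-1,1]$ be a continuous odd function with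 $\psi_n(x)=x$ for $|x|\le \frac1n$, such that $\psi_n$ has compact support contained in $(-\frac1{n-1},\frac1{n-1})$ if $n>1$, and $\psi_1\in C_0(\mathbb R)$ if $n=1$. For $n\ge1$ let $\mathfrak{AS}_n(\mathcal N)$ be the set $AS(\mathcal N)$ with the weakest topology for which the maps $$D\mapsto(\psi_n(D)+i)^{-1}K,\qquad D\mapsto(\psi_n(D)-i)^{-1}K\quad (K\in K(\mathcal N)),\qquad D\mapsto\phi_n(D)$$ are norm continuous. Let $\mathfrak{AS}(\mathcal N)$ be the set $AS(\mathcal N)$ with the direct limit topology of the spaces $\mathfrak{AS}_n(\mathcal N)$, $n\ge1$, along the identity maps (a set is open if and only if it is open in every $\mathfrak{AS}_n(\mathcal N)$). Let $ASF_n(\mathcal N)=\{D\in ASF(\mathcal N)\mid \phi_n(D)\in K(\mathcal N)\}$, let $\mathfrak{ASF}_n(\mathcal N)$ be this set with the subspace topology of $\mathfrak{AS}_n(\mathcal N)$, and let $\mathfrak{ASF}(\mathcal N)$ be the inductive limit of the spaces $\mathfrak{ASF}_n(\mathcal N)$, $n\ge 1$: the union of the sets $ASF_n(\mathcal N)$ with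 the finest topology for which all the inclusions of the $\mathfrak{ASF}_n(\mathcal N)$ are continuous. Then, for every such choice of $\phi$ and $(\psi_n)_{n\ge1}$: 1. The identity induces a continuous map from $AS(\mathcal N)_{gap}$ to $\mathfrak{AS}(\mathcal N)$. 2. The set $ASF(\mathcal N)$ is open in $\mathfrak{AS}(\mathcal N)$. 3. The underlying set of $\mathfrak{ASF}(\mathcal N)$ is $ASF(\mathcal N)$, and the identity is a homeomorphism from $ASF(\mathcal N)$ with the subspace topology of $\mathfrak{AS}(\mathcal N)$ to $\mathfrak{ASF}(\mathcal N)$. -/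

import Mathlib

open scoped ENNReal ContDiff InnerProductSpace
open Topology

namespace SpectralFlow

noncomputable section

/-- `τ` (of which only the values on the positive part of `N` matter) is a faithful normal
semifinite trace on the von Neumann algebra `N`. -/
structure IsFaithfulNormalSemifiniteTrace {H : Type*} [NormedAddCommGroup H]
    [InnerProductSpace ℂ H] [CompleteSpace H] (N : VonNeumannAlgebra H)
    (τ : (H →L[ℂ] H) → ℝ≥0∞) : Prop where
  map_add : ∀ x ∈ N, ∀ y ∈ N, 0 ≤ x → 0 ≤ y → τ (x + y) = τ x + τ y
  map_smul : ∀ c : NNReal, ∀ x ∈ N, 0 ≤ x → τ (((c : ℝ) : ℂ) • x) = (c : ℝ≥0∞) * τ x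
  tracial : ∀ x ∈ N, τ (star x * x) = τ (x * star x)
  faithful : ∀ x ∈ N, 0 ≤ x → τ x = 0 → x = 0
  /-- Suprema of bounded increasing nets of positive elements are preserved. -/
  normal : ∀ S : Set (H →L[ℂ] H), S.Nonempty → DirectedOn (· ≤ ·) S →
    (∀ x ∈ S, x ∈ N ∧ 0 ≤ x) → ∀ s ∈ N, IsLUB S s → τ s = ⨆ x ∈ S, τ x
  semifinite : ∀ x ∈ N, 0 ≤ x → x ≠ 0 → ∃ y ∈ N, 0 ≤ y ∧ y ≤ x ∧ y ≠ 0 ∧ τ y < ⊤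

section

variable {H : Type*} [NormedAddCommGroup H] [InnerProductSpace ℂ H] [CompleteSpace H]

/-- `K(N)`: the norm-closed two-sided ideal of `N` generated by the projections of finite trace,
that is, the smallest norm-closed two-sided ideal of `N` that contains them. -/
def compactIdeal (N : VonNeumannAlgebra H) (τ : (H →L[ℂ] H) → ℝ≥0∞) : TwoSidedIdeal N :=
  sInf {I : TwoSidedIdeal N | IsClosed (I : Set N) ∧
    ∀ p : N, IsStarProjection (p : H →L[ℂ] H) → τ (p : H →L[ℂ] H) < ⊤ → p ∈ I}

/-- The quotient algebra `Q(N) = N / K(N)`. -/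
abbrev CalkinQuotient (N : VonNeumannAlgebra H) (τ : (H →L[ℂ] H) → ℝ≥0∞) : Type _ :=
  (compactIdeal N τ).ringCon.Quotient

/-- The projection `π : N → Q(N)`. -/
def calkinProj (N : VonNeumannAlgebra H) (τ : (H →L[ℂ] H) → ℝ≥0∞) :
    N →+* CalkinQuotient N τ :=
  (compactIdeal N τ).ringCon.mk'

theorem norm_sq_graph {D : H →ₗ.[ℂ] H} (hD : IsSelfAdjoint D) {g : H × H} (hg : g ∈ D.graph) :
    ‖g.2 + Complex.I • g.1‖ ^ 2 = ‖g.2‖ ^ 2 + ‖g.1‖ ^ 2 := by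
  obtain ⟨x, w⟩ := g
  obtain ⟨x', rfl, rfl⟩ := (LinearPMap.mem_graph_iff D).1 hg
  have hs : D.IsFormalAdjoint D := by
    have h := LinearPMap.adjoint_isFormalAdjoint hD.dense_domain
    rwa [LinearPMap.isSelfAdjoint_def.1 hD] at h
  have h1 : ⟪D x', (x' : H)⟫_ℂ = ⟪(x' : H), D x'⟫_ℂ := hs x' x'
  have h2 : (⟪D x', (x' : H)⟫_ℂ).im = 0 := by
    have h3 := inner_conj_symm (𝕜 := ℂ) (D x') (x' : H)
    rw [← h1] at h3
    exact Complex.conj_eq_iff_im.1 h3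
  have h4 : ‖D x' + Complex.I • (x' : H)‖ ^ 2 = ‖D x'‖ ^ 2
      + 2 * (⟪D x', Complex.I • (x' : H)⟫_ℂ).re + ‖Complex.I • (x' : H)‖ ^ 2 :=
    norm_add_sq (𝕜 := ℂ) _ _
  rw [inner_smul_right] at h4
  simp only [norm_smul, Complex.norm_I, one_mul, Complex.mul_re, Complex.I_re, Complex.I_im,
    h2] at h4
  simpa using h4

/-- For selfadjoint `D` the operator `D + i` has an everywhere defined bounded inverse: there is
exactly one `R ∈ B(H)` such that, for all `y`, `R y ∈ dom D` and `D (R y) = y - i R y`. -/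
theorem existsUnique_resolvent {D : H →ₗ.[ℂ] H} (hD : IsSelfAdjoint D) :
    ∃! R : H →L[ℂ] H, ∀ y : H, (R y, y - Complex.I • R y) ∈ D.graph := by
  let T : D.graph →L[ℂ] H :=
    (ContinuousLinearMap.snd ℂ H H + Complex.I • ContinuousLinearMap.fst ℂ H H).comp
      D.graph.subtypeL
  have hT : ∀ g : D.graph, T g = (g : H × H).2 + Complex.I • (g : H × H).1 := fun g => rfl
  have hnorm : ∀ g : D.graph, ‖T g‖ ^ 2 = ‖(g : H × H).2‖ ^ 2 + ‖(g : H × H).1‖ ^ 2 :=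
    fun g => by rw [hT]; exact norm_sq_graph hD g.2
  have hbound : ∀ g : D.graph, ‖g‖ ≤ 1 * ‖T g‖ := by
    intro g
    rw [one_mul, Submodule.coe_norm, Prod.norm_def]
    have := hnorm g
    refine max_le ?_ ?_ <;> refine le_of_sq_le_sq ?_ (norm_nonneg _) <;> rw [this] <;>
      nlinarith [sq_nonneg ‖(g : H × H).1‖, sq_nonneg ‖(g : H × H).2‖]
  have hanti : AntilipschitzWith 1 T := by
    refine AddMonoidHomClass.antilipschitz_of_bound T (K := 1) ?_
    simpa using hbound
  have hclosed : IsClosed (D.graph : Set (H × H)) := hD.isClosed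
  have : CompleteSpace D.graph := hclosed.completeSpace_coe
  have hrange : IsClosed (Set.range T) := hanti.isClosed_range T.uniformContinuous
  have hinj : Function.Injective T := hanti.injective
  have hsurj : Function.Surjective T := by
    have hc : IsClosed (T.range : Set H) := hrange
    have : CompleteSpace T.range := hc.completeSpace_coe
    have htop : T.range = ⊤ := by
      rw [← Submodule.orthogonal_eq_bot_iff, Submodule.eq_bot_iff]
      intro y hy
      rw [Submodule.mem_orthogonal'] at hy
      have h1 : ∀ x : D.domain, ⟪Complex.I • y, (x : H)⟫_ℂ = ⟪y, D x⟫_ℂ := by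
        intro x
        have h2 := hy (T ⟨((x : H), D x), D.mem_graph x⟩) ⟨_, rfl⟩
        rw [hT] at h2
        simp only [inner_add_right, inner_smul_right] at h2
        rw [inner_smul_left, Complex.conj_I]
        linear_combination -h2
      have hyd : y ∈ (LinearPMap.adjoint D).domain :=
        LinearPMap.mem_adjoint_domain_of_exists y ⟨_, h1⟩
      have hya : LinearPMap.adjoint D ⟨y, hyd⟩ = Complex.I • y :=
        LinearPMap.adjoint_apply_eq hD.dense_domain ⟨y, hyd⟩ h1
      have hg : (y, Complex.I • y) ∈ D.graph := by
        have h3 : (y, Complex.I • y) ∈ (LinearPMap.adjoint D).graph :=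
          (LinearPMap.mem_graph_iff _).2 ⟨⟨y, hyd⟩, rfl, hya⟩
        rwa [LinearPMap.isSelfAdjoint_def.1 hD] at h3
      have h5 := norm_sq_graph hD hg
      simp only [← two_smul ℂ (Complex.I • y), norm_smul, Complex.norm_I, one_mul] at h5
      norm_num at h5
      have : ‖y‖ ^ 2 = 0 := by nlinarith
      simpa using this
    intro y
    have : y ∈ T.range := htop ▸ Submodule.mem_top
    exact this
  let e : D.graph ≃L[ℂ] H :=
    ContinuousLinearEquiv.ofBijective T (LinearMap.ker_eq_bot.2 hinj)
      (LinearMap.range_eq_top.2 hsurj)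
  refine ⟨(ContinuousLinearMap.fst ℂ H H).comp
    (D.graph.subtypeL.comp (e.symm : H →L[ℂ] D.graph)), ?_, ?_⟩
  · intro y
    have h6 : T (e.symm y) = y := e.apply_symm_apply y
    have h7 : y - Complex.I • (e.symm y : H × H).1 = (e.symm y : H × H).2 := by
      rw [sub_eq_iff_eq_add, ← hT, h6]
    show ((e.symm y : H × H).1, y - Complex.I • (e.symm y : H × H).1) ∈ D.graph
    rw [h7]
    exact (e.symm y).2
  · intro R hR
    ext y
    have h8 : T ⟨_, hR y⟩ = y := by rw [hT]; simp
    have h9 : e.symm y = ⟨_, hR y⟩ := by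
      rw [ContinuousLinearEquiv.symm_apply_eq]; exact h8.symm
    show R y = (e.symm y : H × H).1
    rw [h9]

/-- The resolvent `(D + i)⁻¹ ∈ B(H)` of a selfadjoint operator `D`. -/
def resolventI (D : H →ₗ.[ℂ] H) (hD : IsSelfAdjoint D) : H →L[ℂ] H :=
  (existsUnique_resolvent hD).choose

theorem resolventI_mem_graph (D : H →ₗ.[ℂ] H) (hD : IsSelfAdjoint D) (y : H) :
    (resolventI D hD y, y - Complex.I • resolventI D hD y) ∈ D.graph :=
  (existsUnique_resolvent hD).choose_spec.1 y

/-- `f(D)` for a selfadjoint operator `D` and `f ∈ C₀(ℝ)`. The function `x ↦ (x + i)⁻¹` is a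
homeomorphism of `ℝ ∪ {∞}` onto a circle `C ∋ 0` (with `∞ ↦ 0`) that contains the spectrum of the
normal operator `(D + i)⁻¹`; `f(D)` is the continuous functional calculus of `(D + i)⁻¹` applied
to the function on `C` that corresponds to `f`, extended by `f(∞) = 0`. -/
def funCalc (f : ℝ → ℝ) (D : H →ₗ.[ℂ] H) (hD : IsSelfAdjoint D) : H →L[ℂ] H :=
  cfc (fun z : ℂ => if z = 0 then 0 else ((f (z⁻¹ - Complex.I).re : ℝ) : ℂ)) (resolventI D hD)

/-- `F` is the bounded transform `F_D = D (1 + D^* D)^{-1/2} = D (1 + D ^ 2)^{-1/2}` of the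
selfadjoint operator `D`: for every `x` the vector `(1 + D ^ 2)^{-1/2} x` lies in the domain of `D`
and is mapped by `D` to `F x`. -/
def IsBoundedTransform (D : H →ₗ.[ℂ] H) (hD : IsSelfAdjoint D) (F : H →L[ℂ] H) : Prop :=
  ∀ x : H, (funCalc (fun t => (Real.sqrt (1 + t ^ 2))⁻¹) D hD x, F x) ∈ D.graph

/-- `AS(N)`: the selfadjoint operators `D` on `H` that are affiliated to `N`, which means that the
bounded transform of `D` is in `N`. -/
def AffiliatedSA (N : VonNeumannAlgebra H) : Type _ :=
  {D : H →ₗ.[ℂ] H // ∃ hD : IsSelfAdjoint D, ∃ F ∈ N, IsBoundedTransform D hD F}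

namespace AffiliatedSA

variable {N : VonNeumannAlgebra H}

theorem isSelfAdjoint (D : AffiliatedSA N) : IsSelfAdjoint D.1 := D.2.choose

/-- `(D + i)⁻¹`. -/
def res (D : AffiliatedSA N) : H →L[ℂ] H := resolventI D.1 D.isSelfAdjoint

/-- `f(D)` for `f ∈ C₀(ℝ)`. -/
def app (f : ℝ → ℝ) (D : AffiliatedSA N) : H →L[ℂ] H := funCalc f D.1 D.isSelfAdjoint

end AffiliatedSA

/-- `ASF(N)`: the selfadjoint Breuer-Fredholm operators, that is, those `D ∈ AS(N)` for which
`π(F_D)` is invertible in `Q(N)`. -/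
def ASF (N : VonNeumannAlgebra H) (τ : (H →L[ℂ] H) → ℝ≥0∞) : Set (AffiliatedSA N) :=
  {D | ∃ F : N, IsBoundedTransform D.1 D.isSelfAdjoint F ∧ IsUnit (calkinProj N τ F)}

/-- The gap topology on `AS(N)`: the weakest topology for which `D ↦ (D + i)⁻¹` is continuous
(for the operator norm). -/
def gapTopology (N : VonNeumannAlgebra H) : TopologicalSpace (AffiliatedSA N) :=
  TopologicalSpace.induced AffiliatedSA.res inferInstance

end

/-- The admissible functions `φ`; `φ_n(x) = φ(n x)`. -/
structure IsBump (φ : ℝ → ℝ) : Prop where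
  smooth : ContDiff ℝ ∞ φ
  even : ∀ x, φ (-x) = φ x
  tsupport_eq : tsupport φ = Set.Icc (-1) 1
  deriv_pos : ∀ x ∈ Set.Ioo (-1 : ℝ) 0, 0 < deriv φ x

/-- The admissible sequences `(ψ_n)`, `n ≥ 1`. For `n = 1` only `ψ_1 ∈ C₀(ℝ)` is required instead
of a condition on the support. -/
structure IsTruncation (ψ : ℕ+ → ℝ → ℝ) : Prop where
  continuous : ∀ n, Continuous (ψ n)
  odd : ∀ n x, ψ n (-x) = -ψ n x
  mem_Icc : ∀ n x, ψ n x ∈ Set.Icc (-1 : ℝ) 1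
  eq_self : ∀ (n : ℕ+), ∀ x ∈ Set.Icc (-(1 / (n : ℝ))) (1 / (n : ℝ)), ψ n x = x
  hasCompactSupport : ∀ n : ℕ+, 1 < n → HasCompactSupport (ψ n)
  tsupport_subset : ∀ n : ℕ+, 1 < n →
    tsupport (ψ n) ⊆ Set.Ioo (-(1 / ((n : ℝ) - 1))) (1 / ((n : ℝ) - 1))
  zero_at_infty : Filter.Tendsto (ψ 1) (Filter.cocompact ℝ) (𝓝 0)

section

variable {H : Type*} [NormedAddCommGroup H] [InnerProductSpace ℂ H] [CompleteSpace H]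

/-- The topology of `𝔄𝔖_n(N)`: the weakest topology on `AS(N)` for which the maps
`D ↦ (ψ_n(D) + i)⁻¹ K`, `D ↦ (ψ_n(D) - i)⁻¹ K` (for all `K ∈ K(N)`) and `D ↦ φ_n(D)` are continuous
for the operator norm. -/
def asnTopology (N : VonNeumannAlgebra H) (τ : (H →L[ℂ] H) → ℝ≥0∞) (φ : ℝ → ℝ)
    (ψ : ℕ+ → ℝ → ℝ) (n : ℕ+) : TopologicalSpace (AffiliatedSA N) :=
  (⨅ K : compactIdeal N τ, TopologicalSpace.induced
    (fun D : AffiliatedSA N =>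
      Ring.inverse (D.app (ψ n) + Complex.I • (1 : H →L[ℂ] H)) * ((K : N) : H →L[ℂ] H))
    inferInstance) ⊓
  (⨅ K : compactIdeal N τ, TopologicalSpace.induced
    (fun D : AffiliatedSA N =>
      Ring.inverse (D.app (ψ n) - Complex.I • (1 : H →L[ℂ] H)) * ((K : N) : H →L[ℂ] H))
    inferInstance) ⊓
  TopologicalSpace.induced
    (fun D : AffiliatedSA N => D.app (fun x => φ ((n : ℝ) * x))) inferInstance

/-- The topology of `𝔄𝔖(N)`: the direct limit of the spaces `𝔄𝔖_n(N)`, `n ≥ 1`, along the identity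
maps, that is, the finest topology on `AS(N)` for which all the identity maps from `𝔄𝔖_n(N)` are
continuous (a set is open if and only if it is open in every `𝔄𝔖_n(N)`). -/
def asTopology (N : VonNeumannAlgebra H) (τ : (H →L[ℂ] H) → ℝ≥0∞) (φ : ℝ → ℝ)
    (ψ : ℕ+ → ℝ → ℝ) : TopologicalSpace (AffiliatedSA N) :=
  ⨆ n : ℕ+, asnTopology N τ φ ψ n

/-- `ASF_n(N)`: the set of the `D ∈ ASF(N)` with `φ_n(D) ∈ K(N)`. -/
def ASFn (N : VonNeumannAlgebra H) (τ : (H →L[ℂ] H) → ℝ≥0∞) (φ : ℝ → ℝ) (n : ℕ+) :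
    Set (AffiliatedSA N) :=
  {D | D ∈ ASF N τ ∧
    ∃ K ∈ compactIdeal N τ, ((K : N) : H →L[ℂ] H) = D.app (fun x => φ ((n : ℝ) * x))}

/-- The underlying set of the inductive limit of the `ASF_n(N)`: their union. -/
def ASFlim (N : VonNeumannAlgebra H) (τ : (H →L[ℂ] H) → ℝ≥0∞) (φ : ℝ → ℝ) :
    Set (AffiliatedSA N) :=
  ⋃ n : ℕ+, ASFn N τ φ n

/-- The topology of `𝔄𝔖𝔉(N)`: the inductive limit of the spaces `𝔄𝔖𝔉_n(N)`, which are the sets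
`ASF_n(N)` with the subspace topologies of `𝔄𝔖_n(N)`; that is, the finest topology on the union of
the `ASF_n(N)` for which all the inclusions of the `𝔄𝔖𝔉_n(N)` are continuous. -/
def asfTopology (N : VonNeumannAlgebra H) (τ : (H →L[ℂ] H) → ℝ≥0∞) (φ : ℝ → ℝ)
    (ψ : ℕ+ → ℝ → ℝ) : TopologicalSpace (ASFlim N τ φ) :=
  ⨆ n : ℕ+, TopologicalSpace.coinduced
    (Set.inclusion (Set.subset_iUnion (ASFn N τ φ) n))
    (TopologicalSpace.induced ((↑) : ASFn N τ φ n → AffiliatedSA N) (asnTopology N τ φ ψ n))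

end

end

end SpectralFlow

/-! Everything rests on two facts. First, the topologies of `asnTopology` become coarser as `n`
grows (`asnTopology_mono`). For `n < m`, `ψ_m` lives where `φ_n > 0` and `ψ_n(x) = x`, so `ψ_m =
g(φ_n) · ψ_m(ψ_n)`; and since `φ` is strictly monotone on `[-1, 0]`, `φ_m` is a continuous function
of `φ_n`. Functions of `φ_n(D)` stay norm continuous, and functions of `ψ_n(D)` stay continuous
after multiplication by elements of `K(N)` (`StrictContinuous`).

Second, `D` is Breuer-Fredholm iff `φ_m(D) ∈ K(N)` for some `m`, and then `m` may be taken
arbitrarily large (`mem_ASF_of_memCompactIdeal`, `exists_memCompactIdeal_of_mem_ASF`). This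
condition is stable: if `φ_m(D')` is closer than `φ(1/2)` to an element of `K(N)`, then `φ_{2m}(D')
∈ K(N)` (`mem_ASFn_of_norm_sub_lt`). So for each `n`, a Fredholm `D` has an `n`-neighbourhood inside
one `ASFn` of index at least `n` (`exists_eventually_mem_ASFn`). That gives openness. It also gives
the homeomorphism, because a set open in the inductive limit is cut out near `D` by a set open for
that larger index, hence open for `n`.

Continuity from the gap topology holds already into the space of index 1, since `f(D)` is gap
continuous for every `f ∈ C₀(ℝ)`. -/

namespace SpectralFlow

noncomputable section

/-! ### The resolvent, the Cayley transform and the resolvent circle. -/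

section Resolvent

theorem snd_eq_of_mem_graph {H : Type*} [NormedAddCommGroup H] [InnerProductSpace ℂ H]
    {D : H →ₗ.[ℂ] H} {x w w' : H} (h : (x, w) ∈ D.graph) (h' : (x, w') ∈ D.graph) :
    w = w' := by
  have h1 := D.graph.sub_mem h h'
  simp only [Prod.mk_sub_mk, sub_self] at h1
  exact sub_eq_zero.1 (LinearPMap.graph_fst_eq_zero_snd D h1 rfl)

variable {H : Type*} [NormedAddCommGroup H] [InnerProductSpace ℂ H] [CompleteSpace H]
  {D : H →ₗ.[ℂ] H}

theorem inner_graph_comm (hD : IsSelfAdjoint D) {g h : H × H} (hg : g ∈ D.graph)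
    (hh : h ∈ D.graph) : ⟪g.2, h.1⟫_ℂ = ⟪g.1, h.2⟫_ℂ := by
  obtain ⟨x, w⟩ := g
  obtain ⟨y, v⟩ := h
  obtain ⟨x', rfl, rfl⟩ := (LinearPMap.mem_graph_iff D).1 hg
  obtain ⟨y', rfl, rfl⟩ := (LinearPMap.mem_graph_iff D).1 hh
  have hs : D.IsFormalAdjoint D := by
    have h := LinearPMap.adjoint_isFormalAdjoint hD.dense_domain
    rwa [LinearPMap.isSelfAdjoint_def.1 hD] at h
  exact hs x' y'

theorem eq_zero_of_mem_graph_neg_I (hD : IsSelfAdjoint D) {u : H}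
    (hu : (u, -(Complex.I • u)) ∈ D.graph) : u = 0 := by
  have h := norm_sq_graph hD hu
  simp only [neg_add_cancel, norm_zero, norm_neg, norm_smul, Complex.norm_I, one_mul] at h
  have : ‖u‖ ^ 2 = 0 := by nlinarith [sq_nonneg ‖u‖]
  simpa using this

theorem resolventI_apply_of_mem_graph (hD : IsSelfAdjoint D) {x w : H} (h : (x, w) ∈ D.graph) :
    resolventI D hD (w + Complex.I • x) = x := by
  have h1 := D.graph.sub_mem (resolventI_mem_graph D hD (w + Complex.I • x)) h
  rw [← sub_eq_zero]
  refine eq_zero_of_mem_graph_neg_I hD ?_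
  convert h1 using 1
  simp only [Prod.mk_sub_mk, Prod.mk.injEq, true_and, smul_sub]
  abel

theorem resolventI_injective (hD : IsSelfAdjoint D) : Function.Injective (resolventI D hD) := by
  rw [injective_iff_map_eq_zero]
  intro y hy
  have h := resolventI_mem_graph D hD y
  rw [hy, smul_zero, sub_zero] at h
  exact LinearPMap.graph_fst_eq_zero_snd D h rfl

/-- Symmetry of `D` tested on the vectors `R y` and `R z`. This acts as the resolvent identity
between `R` and `R*` without identifying `R*` with `(D - i)⁻¹`. -/
theorem resolventI_sub_star (hD : IsSelfAdjoint D) :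
    resolventI D hD - star (resolventI D hD) =
      -((2 * Complex.I) • (star (resolventI D hD) * resolventI D hD)) := by
  set R := resolventI D hD with hR
  ext z
  refine ext_inner_left ℂ fun y => ?_
  have h := inner_graph_comm hD (resolventI_mem_graph D hD y) (resolventI_mem_graph D hD z)
  rw [← hR] at h
  simp only [inner_sub_left, inner_sub_right, inner_smul_left, inner_smul_right,
    Complex.conj_I] at h
  simp only [sub_apply, neg_apply,
    smul_apply, mul_apply_eq_comp, inner_sub_right,
    inner_neg_right, inner_smul_right, ContinuousLinearMap.star_eq_adjoint,
    ContinuousLinearMap.adjoint_inner_right]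
  linear_combination h

/-- The Cayley transform `1 - 2i (D + i)⁻¹ = (D - i)(D + i)⁻¹`. -/
def cayley (D : H →ₗ.[ℂ] H) (hD : IsSelfAdjoint D) : H →L[ℂ] H :=
  1 - (2 * Complex.I) • resolventI D hD

theorem star_cayley_mul_self (hD : IsSelfAdjoint D) : star (cayley D hD) * cayley D hD = 1 := by
  have h := resolventI_sub_star hD
  have h2 : star (cayley D hD) = 1 + (2 * Complex.I) • star (resolventI D hD) := by
    simp [cayley, star_smul, sub_eq_add_neg]
  rw [h2, cayley]
  set R := resolventI D hD
  have h3 : (1 + (2 * Complex.I) • star R) * (1 - (2 * Complex.I) • R)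
      = 1 - (2 * Complex.I) • (R - star R)
        - ((2 * Complex.I) * (2 * Complex.I)) • (star R * R) := by
    simp only [add_mul, mul_sub, one_mul, mul_one, smul_mul_assoc, mul_smul_comm]
    module
  rw [h3, h, smul_neg, smul_smul]
  abel

/-- A kernel vector `y` of `U*` lies in the domain of the adjoint of `D`, which is `D`, with `D y =
-i y`, so it vanishes. Since `U*(U U* - 1) = 0` by isometry, injectivity of `U*` finishes. -/
theorem cayley_mul_star_self (hD : IsSelfAdjoint D) : cayley D hD * star (cayley D hD) = 1 := by
  have h2 : star (cayley D hD) = 1 + (2 * Complex.I) • star (resolventI D hD) := by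
    simp [cayley, star_smul, sub_eq_add_neg]
  have hinj : ∀ y, star (cayley D hD) y = 0 → y = 0 := by
    intro y hy
    rw [h2] at hy
    simp only [add_apply, one_apply_eq_self,
      smul_apply, ContinuousLinearMap.star_eq_adjoint] at hy
    have h1 : ∀ x : D.domain, ⟪-(Complex.I • y), (x : H)⟫_ℂ = ⟪y, D x⟫_ℂ := by
      intro x
      have h3 := resolventI_apply_of_mem_graph hD (D.mem_graph x)
      have h4 : ⟪y + (2 * Complex.I) • (ContinuousLinearMap.adjoint (resolventI D hD)) y,
          D x + Complex.I • (x : H)⟫_ℂ = 0 := by rw [hy, inner_zero_left]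
      rw [inner_add_left, inner_smul_left, ContinuousLinearMap.adjoint_inner_left, h3,
        inner_add_right, inner_smul_right] at h4
      rw [inner_neg_left, inner_smul_left, Complex.conj_I]
      simp only [map_mul, Complex.conj_I, map_ofNat] at h4
      linear_combination -h4
    have hyd : y ∈ (LinearPMap.adjoint D).domain :=
      LinearPMap.mem_adjoint_domain_of_exists y ⟨_, h1⟩
    have hya : LinearPMap.adjoint D ⟨y, hyd⟩ = -(Complex.I • y) :=
      LinearPMap.adjoint_apply_eq hD.dense_domain ⟨y, hyd⟩ h1
    refine eq_zero_of_mem_graph_neg_I hD ?_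
    have h3 : (y, -(Complex.I • y)) ∈ (LinearPMap.adjoint D).graph :=
      (LinearPMap.mem_graph_iff _).2 ⟨⟨y, hyd⟩, rfl, hya⟩
    rwa [LinearPMap.isSelfAdjoint_def.1 hD] at h3
  ext y
  rw [← sub_eq_zero]
  refine hinj _ ?_
  have h := star_cayley_mul_self hD
  have h5 := congrArg (fun T : H →L[ℂ] H => (T * star (cayley D hD)) y) h
  simpa [mul_assoc, sub_eq_zero] using h5

theorem cayley_mem_unitary (hD : IsSelfAdjoint D) : cayley D hD ∈ unitary (H →L[ℂ] H) :=
  ⟨star_cayley_mul_self hD, cayley_mul_star_self hD⟩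

theorem resolventI_eq_cayley (hD : IsSelfAdjoint D) :
    resolventI D hD = (2 * Complex.I)⁻¹ • (1 - cayley D hD) := by
  rw [cayley, sub_sub_cancel, inv_smul_smul₀]
  simp

instance isStarNormal_resolventI (hD : IsSelfAdjoint D) : IsStarNormal (resolventI D hD) := by
  refine ⟨?_⟩
  have h1 := star_cayley_mul_self hD
  have h2 := cayley_mul_star_self hD
  rw [resolventI_eq_cayley hD]
  refine Commute.smul_right ?_ _
  rw [star_smul]
  refine Commute.smul_left ?_ _
  rw [star_sub, star_one]
  have : Commute (star (cayley D hD)) (cayley D hD) := h1.trans h2.symm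
  exact ((Commute.one_left _).sub_left (((Commute.one_right _).sub_right this)))

/-- The circle that contains the spectra of the resolvents `(D + i)⁻¹`. -/
def resolventCircle : Set ℂ := {z | ‖1 - (2 * Complex.I) * z‖ = 1}

theorem isCompact_resolventCircle : IsCompact resolventCircle := by
  refine Metric.isCompact_of_isClosed_isBounded
    (isClosed_eq (by fun_prop) continuous_const) ?_
  refine (Metric.isBounded_closedBall (x := (0 : ℂ)) (r := 1)).subset fun z hz => ?_
  have hz' : ‖1 - (2 * Complex.I) * z‖ = 1 := hz
  have h : ‖(2 * Complex.I) * z‖ ≤ ‖(1 : ℂ)‖ + ‖1 - (2 * Complex.I) * z‖ := by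
    simpa using norm_sub_le (1 : ℂ) (1 - (2 * Complex.I) * z)
  rw [hz'] at h
  simp only [norm_mul, Complex.norm_ofNat, Complex.norm_I, mul_one, norm_one] at h
  simp only [Metric.mem_closedBall, dist_zero_right]
  linarith

theorem spectrum_resolventI_subset (hD : IsSelfAdjoint D) :
    spectrum ℂ (resolventI D hD) ⊆ resolventCircle := by
  intro z hz
  have h : (1 - (2 * Complex.I) * z) ∈ spectrum ℂ (cayley D hD) := by
    have := spectrum.subset_polynomial_aeval (resolventI D hD)
      (1 - Polynomial.C (2 * Complex.I) * Polynomial.X) ⟨z, hz, rfl⟩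
    simpa [cayley, Algebra.smul_def] using this
  have h2 := spectrum.subset_circle_of_unitary (cayley_mem_unitary hD) h
  simpa [resolventCircle] using h2

theorem im_eq_of_mem_resolventCircle {z : ℂ} (hz : z ∈ resolventCircle) :
    z.im = -Complex.normSq z := by
  have h : Complex.normSq (1 - (2 * Complex.I) * z) = 1 := by
    rw [Complex.normSq_eq_norm_sq, show ‖1 - (2 * Complex.I) * z‖ = 1 from hz, one_pow]
  simp [Complex.normSq_apply] at h ⊢
  linarith

/-- With `z = (t + i)⁻¹` and `t` real this is `1 + t² = |z|⁻²`. -/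
theorem re_inv_sq_of_mem_resolventCircle {z : ℂ} (hz : z ∈ resolventCircle) (h0 : z ≠ 0) :
    1 + ((z⁻¹ - Complex.I).re) ^ 2 = (Complex.normSq z)⁻¹ := by
  have h := im_eq_of_mem_resolventCircle hz
  have h1 : Complex.normSq z ≠ 0 := by simpa using h0
  have h2 : Complex.normSq z = z.re ^ 2 + z.im ^ 2 := by rw [Complex.normSq_apply]; ring
  simp only [Complex.sub_re, Complex.inv_re, Complex.I_re, sub_zero]
  field_simp
  rw [h] at h2
  linear_combination -h2

end Resolvent

/-! ### Functional calculus for functions in `C₀(ℝ)`. -/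

section FunCalc

/-- The function on `ℂ` through which `funCalc f` is defined. -/
def circleFun (f : ℝ → ℝ) (z : ℂ) : ℂ :=
  if z = 0 then 0 else ((f (z⁻¹ - Complex.I).re : ℝ) : ℂ)

/-- `f ∈ C₀(ℝ)`. -/
structure IsC0 (f : ℝ → ℝ) : Prop where
  continuous : Continuous f
  zero_at_infty : Filter.Tendsto f (Filter.cocompact ℝ) (𝓝 0)

/-- Only `z = 0` is delicate: there `1 + t² = |z|⁻²` forces `|t| → ∞`, where `f` tends to the value
assigned at `0`. -/
theorem continuousOn_circleFun {f : ℝ → ℝ} (hf : IsC0 f) :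
    ContinuousOn (circleFun f) resolventCircle := by
  intro z hz
  by_cases h0 : z = 0
  · subst h0
    have key : Filter.Tendsto (fun w : ℂ => f (w⁻¹ - Complex.I).re)
        (𝓝[resolventCircle \ {0}] 0) (𝓝 0) := by
      refine hf.zero_at_infty.comp ?_
      rw [← Metric.cobounded_eq_cocompact, ← tendsto_norm_atTop_iff_cobounded,
        Filter.tendsto_atTop]
      intro b
      have hnorm : Filter.Tendsto (fun w : ℂ => (Complex.normSq w)⁻¹)
          (𝓝[resolventCircle \ {0}] 0) Filter.atTop := by
        refine Filter.Tendsto.inv_tendsto_nhdsGT_zero ?_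
        rw [tendsto_nhdsWithin_iff]
        constructor
        · have : Filter.Tendsto Complex.normSq (𝓝 0) (𝓝 (Complex.normSq 0)) :=
            Complex.continuous_normSq.tendsto 0
          rw [map_zero] at this
          exact this.mono_left nhdsWithin_le_nhds
        · filter_upwards [self_mem_nhdsWithin] with w hw
          exact Complex.normSq_pos.2 hw.2
      filter_upwards [hnorm.eventually_ge_atTop (1 + b ^ 2), self_mem_nhdsWithin] with w h1 h2
      rw [← re_inv_sq_of_mem_resolventCircle h2.1 h2.2] at h1
      rw [Real.norm_eq_abs]
      exact (le_abs_self b).trans (sq_le_sq.1 (by linarith))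
    rw [ContinuousWithinAt, show circleFun f 0 = 0 by simp [circleFun]]
    have key2 : Filter.Tendsto (circleFun f) (𝓝[resolventCircle \ {0}] 0) (𝓝 0) := by
      have h3 : Filter.Tendsto (fun w : ℂ => ((f (w⁻¹ - Complex.I).re : ℝ) : ℂ))
          (𝓝[resolventCircle \ {0}] 0) (𝓝 ((0 : ℝ) : ℂ)) :=
        (Complex.continuous_ofReal.tendsto 0).comp key
      rw [Complex.ofReal_zero] at h3
      refine h3.congr' ?_
      filter_upwards [self_mem_nhdsWithin] with w hw
      rw [circleFun, if_neg (by simpa using hw.2)]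
    rw [Metric.tendsto_nhds] at key2 ⊢
    intro ε hε
    have h4 := eventually_nhdsWithin_iff.1 (key2 ε hε)
    rw [eventually_nhdsWithin_iff]
    filter_upwards [h4] with w hw hwC
    by_cases hw0 : w = 0
    · simpa [hw0, circleFun] using hε
    · exact hw ⟨hwC, hw0⟩
  · have h1 : ContinuousAt (fun w : ℂ => ((f (w⁻¹ - Complex.I).re : ℝ) : ℂ)) z := by
      have h2 : ContinuousAt (fun w : ℂ => (w⁻¹ - Complex.I).re) z :=
        Complex.continuous_re.continuousAt.comp ((continuousAt_inv₀ h0).sub continuousAt_const)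
      exact Complex.continuous_ofReal.continuousAt.comp (hf.continuous.continuousAt.comp h2)
    refine ContinuousAt.continuousWithinAt (h1.congr ?_)
    filter_upwards [isOpen_ne.mem_nhds h0] with w hw
    rw [circleFun, if_neg hw]

variable {H : Type*} [NormedAddCommGroup H] [InnerProductSpace ℂ H] [CompleteSpace H]
  {D : H →ₗ.[ℂ] H} (hD : IsSelfAdjoint D)

theorem continuousOn_circleFun_spectrum {f : ℝ → ℝ} (hf : IsC0 f) :
    ContinuousOn (circleFun f) (spectrum ℂ (resolventI D hD)) :=
  (continuousOn_circleFun hf).mono (spectrum_resolventI_subset hD)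

theorem funCalc_eq (f : ℝ → ℝ) : funCalc f D hD = cfc (circleFun f) (resolventI D hD) := rfl

theorem funCalc_mul {f g : ℝ → ℝ} (hf : IsC0 f) (hg : IsC0 g) :
    funCalc (fun x => f x * g x) D hD = funCalc f D hD * funCalc g D hD := by
  rw [funCalc_eq, funCalc_eq, funCalc_eq, ← cfc_mul (circleFun f) (circleFun g) _
    (continuousOn_circleFun_spectrum hD hf) (continuousOn_circleFun_spectrum hD hg)]
  congr 1
  ext z
  by_cases hz : z = 0 <;> simp [circleFun, hz]

theorem funCalc_add {f g : ℝ → ℝ} (hf : IsC0 f) (hg : IsC0 g) :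
    funCalc (fun x => f x + g x) D hD = funCalc f D hD + funCalc g D hD := by
  rw [funCalc_eq, funCalc_eq, funCalc_eq, ← cfc_add _ (circleFun f) (circleFun g)
    (continuousOn_circleFun_spectrum hD hf) (continuousOn_circleFun_spectrum hD hg)]
  congr 1
  ext z
  by_cases hz : z = 0 <;> simp [circleFun, hz]

theorem funCalc_sub {f g : ℝ → ℝ} (hf : IsC0 f) (hg : IsC0 g) :
    funCalc (fun x => f x - g x) D hD = funCalc f D hD - funCalc g D hD := by
  rw [funCalc_eq, funCalc_eq, funCalc_eq, ← cfc_sub (circleFun f) (circleFun g) _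
    (continuousOn_circleFun_spectrum hD hf) (continuousOn_circleFun_spectrum hD hg)]
  congr 1
  ext z
  by_cases hz : z = 0 <;> simp [circleFun, hz]

theorem isSelfAdjoint_funCalc (f : ℝ → ℝ) : IsSelfAdjoint (funCalc f D hD) := by
  rw [funCalc_eq, isSelfAdjoint_iff, ← cfc_star]
  congr 1
  ext z
  by_cases hz : z = 0 <;> simp [circleFun, hz]

theorem norm_funCalc_le {f : ℝ → ℝ} {c : ℝ} (hc : 0 ≤ c) (h : ∀ x, |f x| ≤ c) :
    ‖funCalc f D hD‖ ≤ c := by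
  rw [funCalc_eq]
  refine norm_cfc_le hc fun z _ => ?_
  by_cases hz : z = 0
  · simpa [circleFun, hz] using hc
  · rw [circleFun, if_neg hz, Complex.norm_real]
    exact h _

theorem spectrum_funCalc_subset {f : ℝ → ℝ} (hf : IsC0 f) {s : Set ℝ} (h0 : (0 : ℝ) ∈ s)
    (h : ∀ x, f x ∈ s) : spectrum ℝ (funCalc f D hD) ⊆ s := by
  intro t ht
  have h1 : (t : ℂ) ∈ spectrum ℂ (funCalc f D hD) := by
    have := spectrum.algebraMap_mem ℂ ht
    simpa using this
  rw [funCalc_eq, cfc_map_spectrum (circleFun f) (resolventI D hD)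
    (ha := isStarNormal_resolventI hD) (hf := continuousOn_circleFun_spectrum hD hf)] at h1
  obtain ⟨z, -, hz⟩ := h1
  by_cases hz0 : z = 0
  · rw [circleFun, if_pos hz0] at hz
    rwa [← Complex.ofReal_eq_zero.1 hz.symm] at h0
  · rw [circleFun, if_neg hz0] at hz
    rw [← Complex.ofReal_injective hz]
    exact h _

theorem funCalc_comp {f g : ℝ → ℝ} (hf : IsC0 f) (hg : Continuous g) (hg0 : g 0 = 0) :
    funCalc (fun x => g (f x)) D hD = cfc g (funCalc f D hD) := by
  rw [cfc_real_eq_complex g (isSelfAdjoint_funCalc hD f), funCalc_eq, funCalc_eq,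
    ← cfc_comp' (fun z : ℂ => ((g z.re : ℝ) : ℂ)) (circleFun f) _ (by fun_prop)
      (continuousOn_circleFun_spectrum hD hf)]
  congr 1
  ext z
  by_cases hz : z = 0 <;> simp [circleFun, hz, hg0]

theorem isC0_inv_one_add_sq : IsC0 (fun t : ℝ => (1 + t ^ 2)⁻¹) := by
  refine ⟨Continuous.inv₀ (by fun_prop) fun t => by positivity, ?_⟩
  refine Filter.Tendsto.inv_tendsto_atTop ?_
  refine Filter.tendsto_atTop_add_const_left _ _ ?_
  have h := (Filter.tendsto_pow_atTop (α := ℝ) two_ne_zero).comp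
    (tendsto_norm_cocompact_atTop (E := ℝ))
  exact h.congr fun t => by simp

theorem isC0_inv_sqrt_one_add_sq : IsC0 (fun t : ℝ => (Real.sqrt (1 + t ^ 2))⁻¹) := by
  refine ⟨Continuous.inv₀ (by fun_prop) fun t => by positivity, ?_⟩
  have h := (Real.continuous_sqrt.tendsto 0).comp isC0_inv_one_add_sq.zero_at_infty
  rw [Real.sqrt_zero] at h
  exact h.congr fun t => by simp [Real.sqrt_inv]

/-- `(1 + D²)⁻¹ = (D + i)⁻¹* (D + i)⁻¹`. -/
theorem funCalc_inv_one_add_sq :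
    funCalc (fun t => (1 + t ^ 2)⁻¹) D hD = star (resolventI D hD) * resolventI D hD := by
  have h1 : star (resolventI D hD) * resolventI D hD
      = cfc (fun z : ℂ => star z * z) (resolventI D hD) := by
    rw [cfc_mul (fun z : ℂ => star z) (fun z => z) _,
      cfc_star_id (resolventI D hD) (isStarNormal_resolventI hD), cfc_id' ℂ (resolventI D hD)]
  rw [h1, funCalc_eq]
  refine cfc_congr fun z hz => ?_
  by_cases h0 : z = 0
  · simp [circleFun, h0]
  · simp only [circleFun, if_neg h0]
    rw [re_inv_sq_of_mem_resolventCircle (spectrum_resolventI_subset hD hz) h0, inv_inv,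
      Complex.normSq_eq_conj_mul_self, Complex.star_def]

end FunCalc

/-! ### The bounded transform and membership in `N`. -/

section BoundedTransform

variable {H : Type*} [NormedAddCommGroup H] [InnerProductSpace ℂ H] [CompleteSpace H]
  {D : H →ₗ.[ℂ] H} {hD : IsSelfAdjoint D} {F : H →L[ℂ] H}

/-- By normality `R = R* - 2i R R*`, so `R* X = 0` implies `R X = 0`, and `R` is injective. Together
with adjoints this cancels `R*` on the left and `R` on the right. -/
theorem eq_zero_of_star_resolventI_mul_eq_zero (hD : IsSelfAdjoint D) {X : H →L[ℂ] H}
    (h : star (resolventI D hD) * X = 0) : X = 0 := by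
  have h1 : Commute (star (resolventI D hD)) (resolventI D hD) :=
    (isStarNormal_resolventI hD).star_comm_self
  have h2 := resolventI_sub_star hD
  rw [h1.eq, sub_eq_iff_eq_add] at h2
  have h3 : resolventI D hD * X = 0 := by
    rw [h2, add_mul, h, neg_mul, smul_mul_assoc, mul_assoc, h]
    simp
  ext y
  refine resolventI_injective hD ?_
  simpa using congrArg (fun T : H →L[ℂ] H => T y) h3

theorem funCalc_inv_sqrt_mul_self (hD : IsSelfAdjoint D) :
    funCalc (fun t => (Real.sqrt (1 + t ^ 2))⁻¹) D hD *
      funCalc (fun t => (Real.sqrt (1 + t ^ 2))⁻¹) D hD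
      = star (resolventI D hD) * resolventI D hD := by
  rw [← funCalc_mul hD isC0_inv_sqrt_one_add_sq isC0_inv_sqrt_one_add_sq,
    ← funCalc_inv_one_add_sq]
  congr 1
  ext t
  rw [← mul_inv, Real.mul_self_sqrt (by positivity)]

theorem commute_funCalc_resolventI (hD : IsSelfAdjoint D) (f : ℝ → ℝ) :
    Commute (funCalc f D hD) (resolventI D hD) :=
  (Commute.refl _).cfc (isStarNormal_resolventI hD).star_comm_self _

theorem commute_funCalc_star_resolventI (hD : IsSelfAdjoint D) (f : ℝ → ℝ) :
    Commute (funCalc f D hD) (star (resolventI D hD)) :=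
  Commute.cfc (isStarNormal_resolventI hD).star_comm_self.symm (Commute.refl _) _

theorem IsBoundedTransform.mul_resolventI (hF : IsBoundedTransform D hD F) :
    F * resolventI D hD = funCalc (fun t => (Real.sqrt (1 + t ^ 2))⁻¹) D hD -
      Complex.I • (resolventI D hD * funCalc (fun t => (Real.sqrt (1 + t ^ 2))⁻¹) D hD) := by
  ext y
  have h1 := hF (resolventI D hD y)
  have h2 := resolventI_mem_graph D hD (funCalc (fun t => (Real.sqrt (1 + t ^ 2))⁻¹) D hD y)
  have h3 := congrArg (fun T : H →L[ℂ] H => T y)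
    (commute_funCalc_resolventI hD (fun t => (Real.sqrt (1 + t ^ 2))⁻¹)).eq
  simp only [mul_apply_eq_comp] at h3
  rw [h3] at h1
  exact snd_eq_of_mem_graph h1 h2

theorem IsBoundedTransform.mul_funCalc (hF : IsBoundedTransform D hD F) :
    F * funCalc (fun t => (Real.sqrt (1 + t ^ 2))⁻¹) D hD = star (resolventI D hD) -
      Complex.I • (star (resolventI D hD) * resolventI D hD) := by
  have h0 : Commute (star (resolventI D hD)) (resolventI D hD) :=
    (isStarNormal_resolventI hD).star_comm_self
  rw [h0.eq]
  ext y
  have h1 := hF (funCalc (fun t => (Real.sqrt (1 + t ^ 2))⁻¹) D hD y)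
  have h2 := resolventI_mem_graph D hD (star (resolventI D hD) y)
  have h3 := congrArg (fun T : H →L[ℂ] H => T y) (funCalc_inv_sqrt_mul_self hD)
  rw [h0.eq] at h3
  simp only [mul_apply_eq_comp] at h3
  rw [h3] at h1
  exact snd_eq_of_mem_graph h1 h2

/-- The sandwich `R* F R` is explicit in `R`, `R*` and `B = (1 + D²)^{-1/2}`, and is visibly
selfadjoint by the relation between `R` and `R*`; the outer factors then cancel. -/
theorem IsBoundedTransform.isSelfAdjoint (hF : IsBoundedTransform D hD F) :
    IsSelfAdjoint F := by
  have hFR := hF.mul_resolventI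
  have hBR := (commute_funCalc_resolventI hD (fun t => (Real.sqrt (1 + t ^ 2))⁻¹)).eq
  have hBS := (commute_funCalc_star_resolventI hD (fun t => (Real.sqrt (1 + t ^ 2))⁻¹)).eq
  have hB : star (funCalc (fun t => (Real.sqrt (1 + t ^ 2))⁻¹) D hD) = _ :=
    isSelfAdjoint_funCalc hD _
  have hrel := resolventI_sub_star hD
  have hcancel := fun X => eq_zero_of_star_resolventI_mul_eq_zero hD (X := X)
  set R := resolventI D hD
  set B := funCalc (fun t => (Real.sqrt (1 + t ^ 2))⁻¹) D hD
  have h1 : star R * (F * R) = star R * B - Complex.I • (star R * R * B) := by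
    rw [hFR, mul_sub, mul_smul_comm, mul_assoc]
  have h2 : star R * (star F * R) = star (star R * (F * R)) := by
    simp [mul_assoc]
  have h3 : star (star R * (F * R)) = R * B + Complex.I • (star R * R * B) := by
    rw [h1]
    simp only [star_sub, star_mul, star_star, star_smul, hB, Complex.star_def, Complex.conj_I]
    rw [← hBR, ← mul_assoc B, hBS, mul_assoc, hBR, mul_assoc]
    module
  have h4 : star R * ((star F - F) * R) = 0 := by
    rw [sub_mul, mul_sub, h2, h3, h1]
    have h5 := congrArg (· * B) hrel
    simp only [sub_mul, neg_mul, smul_mul_assoc] at h5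
    linear_combination (norm := module) h5
  have h5 : star R * (F - star F) = 0 := by
    have := congrArg star (hcancel _ h4)
    simpa using this
  exact (sub_eq_zero.1 (hcancel _ h5)).symm

theorem IsBoundedTransform.mul_self (hF : IsBoundedTransform D hD F) :
    F * F = 1 - star (resolventI D hD) * resolventI D hD := by
  have hFR := hF.mul_resolventI
  have hBR := (commute_funCalc_resolventI hD (fun t => (Real.sqrt (1 + t ^ 2))⁻¹)).eq
  have hBS := (commute_funCalc_star_resolventI hD (fun t => (Real.sqrt (1 + t ^ 2))⁻¹)).eq
  have hBB := funCalc_inv_sqrt_mul_self hD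
  have hB : star (funCalc (fun t => (Real.sqrt (1 + t ^ 2))⁻¹) D hD) = _ :=
    isSelfAdjoint_funCalc hD _
  have hrel := resolventI_sub_star hD
  have hcancel := fun X => eq_zero_of_star_resolventI_mul_eq_zero hD (X := X)
  have hRS : star (resolventI D hD) * (resolventI D hD) = resolventI D hD * star _ :=
    (isStarNormal_resolventI hD).star_comm_self.eq
  have hFF : star F = F := hF.isSelfAdjoint
  set R := resolventI D hD
  set B := funCalc (fun t => (Real.sqrt (1 + t ^ 2))⁻¹) D hD
  have hFS : star R * F = B + Complex.I • (star R * B) := by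
    have := congrArg star hFR
    simp only [star_mul, star_sub, star_smul, hFF, hB, Complex.star_def, Complex.conj_I] at this
    rw [this, hBS]
    module
  have h1 : star R * ((F * F - (1 - star R * R)) * R) = 0 := by
    have h2 : star R * ((F * F - (1 - star R * R)) * R)
        = (star R * F) * (F * R) - star R * R + star R * (star R * R) * R := by noncomm_ring
    rw [h2, hFS, hFR]
    have h3 : (B + Complex.I • (star R * B)) * (B - Complex.I • (R * B))
        = B * B - Complex.I • (R * (B * B)) + Complex.I • (star R * (B * B))
          + star R * R * (B * B) := by
      simp only [add_mul, mul_sub, smul_mul_assoc, mul_smul_comm]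
      rw [← mul_assoc B R B, hBR, mul_assoc R B B,
        show star R * B * (R * B) = star R * R * (B * B) by
          rw [mul_assoc, ← mul_assoc B R B, hBR]; simp only [mul_assoc], mul_assoc (star R) B B]
      match_scalars <;> simp
    have h4 := congrArg (· * (star R * R)) hrel
    simp only [sub_mul, neg_mul, smul_mul_assoc] at h4
    have h5 : star R * (star R * R) * R = star R * R * (star R * R) := by
      rw [mul_assoc (star R) R, ← mul_assoc R, ← hRS, mul_assoc, mul_assoc]
    rw [h3, hBB, h5]
    have h6 : R * (star R * R) - star R * (star R * R)
        = -((2 * Complex.I) • (star R * R * (star R * R))) := h4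
    have h7 := congrArg (fun T => -(Complex.I • T)) h6
    simp only [smul_sub, smul_neg, smul_smul, neg_neg] at h7
    rw [show Complex.I * (2 * Complex.I) = -2 by rw [mul_left_comm, Complex.I_mul_I]; ring] at h7
    linear_combination (norm := module) h7
  have h8 := hcancel _ h1
  have h9 : star R * star (F * F - (1 - star R * R)) = 0 := by
    rw [← star_mul, h8, star_zero]
  have h10 := hcancel _ h9
  rw [star_eq_zero] at h10
  exact sub_eq_zero.1 h10

theorem mem_of_forall_commute {N : VonNeumannAlgebra H} {X : H →L[ℂ] H}
    (h : ∀ T : H →L[ℂ] H, (∀ Y ∈ N, Commute Y T) → Commute X T) : X ∈ N := by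
  rw [← N.commutant_commutant, VonNeumannAlgebra.mem_commutant_iff]
  intro T hT
  rw [VonNeumannAlgebra.mem_commutant_iff] at hT
  exact (h T hT).eq.symm

/-- What commutes with `F` commutes with `R* R = 1 - F²`, hence with its square root `B`, hence with
`R* = F B + i R* R`. The double commutant theorem concludes. -/
theorem IsBoundedTransform.resolventI_mem {N : VonNeumannAlgebra H}
    (hF : IsBoundedTransform D hD F) (hFN : F ∈ N) : resolventI D hD ∈ N := by
  rw [← star_star (resolventI D hD)]
  refine star_mem (mem_of_forall_commute fun T hT => ?_)
  have h1 : Commute F T := hT F hFN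
  have h2 : Commute (star (resolventI D hD) * resolventI D hD) T := by
    have h3 : star (resolventI D hD) * resolventI D hD = 1 - F * F := by rw [hF.mul_self]; abel
    rw [h3]
    exact (Commute.one_left _).sub_left (h1.mul_left h1)
  have h4 : Commute (funCalc (fun t => (Real.sqrt (1 + t ^ 2))⁻¹) D hD) T := by
    have h5 : funCalc (fun t => (Real.sqrt (1 + t ^ 2))⁻¹) D hD
        = cfc Real.sqrt (star (resolventI D hD) * resolventI D hD) := by
      rw [← funCalc_inv_one_add_sq, ← funCalc_comp hD isC0_inv_one_add_sq Real.continuous_sqrt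
        Real.sqrt_zero]
      simp_rw [Real.sqrt_inv]
    rw [h5]
    exact h2.cfc_real _
  have h6 := hF.mul_funCalc
  rw [eq_sub_iff_add_eq] at h6
  rw [← h6]
  exact (h1.mul_left h4).add_left (h2.smul_left _)

theorem funCalc_mem {N : VonNeumannAlgebra H} (h : resolventI D hD ∈ N) (f : ℝ → ℝ) :
    funCalc f D hD ∈ N :=
  mem_of_forall_commute fun _ hT => (hT _ h).cfc (hT _ (star_mem h)) _

end BoundedTransform

/-! ### Closure properties of `C₀(ℝ)`. -/

section IsC0

theorem IsC0.of_forall_eq_zero {f : ℝ → ℝ} (hf : Continuous f) (r : ℝ)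
    (h : ∀ x, r ≤ |x| → f x = 0) : IsC0 f := by
  refine ⟨hf, tendsto_const_nhds.congr' ?_⟩
  have h1 := (tendsto_norm_cocompact_atTop (E := ℝ)).eventually_ge_atTop r
  filter_upwards [h1] with x hx
  exact (h x hx).symm

theorem IsC0.mul {f g : ℝ → ℝ} (hf : IsC0 f) (hg : IsC0 g) : IsC0 (fun x => f x * g x) :=
  ⟨hf.continuous.mul hg.continuous, by simpa using hf.zero_at_infty.mul hg.zero_at_infty⟩

theorem IsC0.sub {f g : ℝ → ℝ} (hf : IsC0 f) (hg : IsC0 g) : IsC0 (fun x => f x - g x) :=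
  ⟨hf.continuous.sub hg.continuous, by simpa using hf.zero_at_infty.sub hg.zero_at_infty⟩

theorem IsC0.comp {f g : ℝ → ℝ} (hf : IsC0 f) (hg : Continuous g) (hg0 : g 0 = 0) :
    IsC0 (fun x => g (f x)) :=
  ⟨hg.comp hf.continuous, by
    have h := (hg.tendsto 0).comp hf.zero_at_infty
    rwa [hg0] at h⟩

theorem IsC0.of_abs_le {f g : ℝ → ℝ} (hg : IsC0 g) (hf : Continuous f)
    (h : ∀ x, |f x| ≤ g x) : IsC0 f :=
  ⟨hf, squeeze_zero_norm h hg.zero_at_infty⟩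

end IsC0

/-! ### Monotonicity and support of the bump function. -/

section Bump

variable {φ : ℝ → ℝ}

theorem IsBump.eq_zero (hφ : IsBump φ) {x : ℝ} (hx : 1 ≤ |x|) : φ x = 0 := by
  have h1 : ∀ y : ℝ, y < -1 → φ y = 0 := fun y hy => by
    refine image_eq_zero_of_notMem_tsupport ?_
    rw [hφ.tsupport_eq]
    exact fun h => absurd h.1 (not_le.2 hy)
  have h2 : ∀ y : ℝ, y ≤ -1 → φ y = 0 := by
    have hc : IsClosed {y : ℝ | φ y = 0} := isClosed_eq hφ.smooth.continuous continuous_const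
    have h3 := closure_minimal (s := Set.Iio (-1 : ℝ)) h1 hc
    rw [closure_Iio] at h3
    exact h3
  rcases le_abs.1 hx with h | h
  · rw [← neg_neg x, hφ.even]
    exact h2 _ (by linarith)
  · exact h2 _ (by linarith)

theorem IsBump.strictMonoOn (hφ : IsBump φ) : StrictMonoOn φ (Set.Icc (-1) 0) := by
  refine strictMonoOn_of_deriv_pos (convex_Icc _ _) hφ.smooth.continuous.continuousOn ?_
  rw [interior_Icc]
  exact hφ.deriv_pos

theorem IsBump.apply_neg_abs (hφ : IsBump φ) (x : ℝ) : φ (-|x|) = φ x := by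
  rcases abs_choice x with h | h <;> rw [h]
  · exact hφ.even x
  · rw [neg_neg]

theorem IsBump.apply_le (hφ : IsBump φ) {x y : ℝ} (h : |x| ≤ |y|) (hy : |y| ≤ 1) :
    φ y ≤ φ x := by
  rw [← hφ.apply_neg_abs x, ← hφ.apply_neg_abs y]
  refine hφ.strictMonoOn.monotoneOn ⟨?_, ?_⟩ ⟨?_, ?_⟩ ?_ <;>
    linarith [abs_nonneg x, abs_nonneg y]

theorem IsBump.pos (hφ : IsBump φ) {x : ℝ} (hx : |x| < 1) : 0 < φ x := by
  rw [← hφ.apply_neg_abs x, ← hφ.eq_zero (x := -1) (by simp)]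
  refine hφ.strictMonoOn ⟨?_, ?_⟩ ⟨?_, ?_⟩ ?_ <;> linarith [abs_nonneg x]

theorem IsBump.nonneg (hφ : IsBump φ) (x : ℝ) : 0 ≤ φ x := by
  rcases lt_or_ge |x| 1 with h | h
  · exact (hφ.pos h).le
  · exact (hφ.eq_zero h).ge

theorem abs_natCast_mul (n : ℕ+) (x : ℝ) : |(n : ℝ) * x| = n * |x| := by
  rw [abs_mul, Nat.abs_cast]

theorem IsBump.isC0 (hφ : IsBump φ) (n : ℕ+) : IsC0 (fun x => φ ((n : ℝ) * x)) := by
  refine IsC0.of_forall_eq_zero (hφ.smooth.continuous.comp (continuous_const_mul _)) 1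
    fun x hx => hφ.eq_zero ?_
  rw [abs_natCast_mul]
  have : (1 : ℝ) ≤ n := by exact_mod_cast n.pos
  nlinarith

end Bump

/-! ### The ideal `K(N)` and the Fredholm criterion. -/

section CompactIdeal

variable {H : Type*} [NormedAddCommGroup H] [InnerProductSpace ℂ H] [CompleteSpace H]
  {N : VonNeumannAlgebra H} {τ : (H →L[ℂ] H) → ℝ≥0∞}

/-- Membership of a bounded operator in `K(N)`. -/
def MemCompactIdeal (N : VonNeumannAlgebra H) (τ : (H →L[ℂ] H) → ℝ≥0∞) (X : H →L[ℂ] H) : Prop :=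
  ∃ K ∈ compactIdeal N τ, ((K : N) : H →L[ℂ] H) = X

namespace MemCompactIdeal

variable {X Y : H →L[ℂ] H}

theorem mem (hX : MemCompactIdeal N τ X) : X ∈ N := by
  obtain ⟨K, -, rfl⟩ := hX
  exact K.2

theorem neg (hX : MemCompactIdeal N τ X) : MemCompactIdeal N τ (-X) := by
  obtain ⟨K, hK, rfl⟩ := hX
  exact ⟨-K, (compactIdeal N τ).neg_mem hK, rfl⟩

theorem mul_left (hX : MemCompactIdeal N τ X) (hY : Y ∈ N) : MemCompactIdeal N τ (Y * X) := by
  obtain ⟨K, hK, rfl⟩ := hX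
  exact ⟨⟨Y, hY⟩ * K, (compactIdeal N τ).mul_mem_left _ _ hK, rfl⟩

theorem mul_right (hX : MemCompactIdeal N τ X) (hY : Y ∈ N) : MemCompactIdeal N τ (X * Y) := by
  obtain ⟨K, hK, rfl⟩ := hX
  exact ⟨K * ⟨Y, hY⟩, (compactIdeal N τ).mul_mem_right _ _ hK, rfl⟩

/-- The Neumann inverse of `1 - T` lies in `N`, so it can be multiplied back inside the ideal. -/
theorem of_one_sub_mul {T : H →L[ℂ] H} (hT : T ∈ N) (hT1 : ‖T‖ < 1)
    (h : MemCompactIdeal N τ ((1 - T) * X)) : MemCompactIdeal N τ X := by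
  set u := Units.oneSub T hT1 with hu
  have h1 : (↑u⁻¹ : H →L[ℂ] H) ∈ N := by
    refine mem_of_forall_commute fun S hS => Commute.units_inv_left ?_
    rw [hu, Units.val_oneSub]
    exact (Commute.one_left _).sub_left (hS T hT)
  have h2 := h.mul_left h1
  rwa [← mul_assoc, ← Units.val_oneSub T hT1, Units.inv_mul, one_mul] at h2

end MemCompactIdeal

theorem calkinProj_eq_iff {X Y : N} :
    calkinProj N τ X = calkinProj N τ Y ↔ X - Y ∈ compactIdeal N τ := by
  rw [← TwoSidedIdeal.rel_iff]
  exact (compactIdeal N τ).ringCon.eq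

namespace AffiliatedSA

variable (D : AffiliatedSA N)

theorem exists_boundedTransform : ∃ F ∈ N, IsBoundedTransform D.1 D.isSelfAdjoint F :=
  D.2.choose_spec

theorem res_mem : D.res ∈ N := by
  obtain ⟨F, hF, h⟩ := D.exists_boundedTransform
  exact h.resolventI_mem hF

theorem app_mem (f : ℝ → ℝ) : D.app f ∈ N := funCalc_mem D.res_mem f

theorem app_zero : D.app (fun _ => 0) = 0 := by
  have h : circleFun (fun _ => 0) = fun _ => 0 := by
    ext z
    simp [circleFun]
  rw [app, funCalc_eq, h, cfc_const_zero]

/-- Functions with limit 1 at infinity fall outside `C₀(ℝ)`; the constant is carried separately. -/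
theorem one_add_app_mul_eq_one {a b : ℝ → ℝ} (ha : IsC0 a) (hb : IsC0 b)
    (h : ∀ x, (1 + a x) * (1 + b x) = 1) : (1 + D.app a) * (1 + D.app b) = 1 := by
  have h1 : D.app (fun x => (a x + a x * b x) + b x) = 0 := by
    rw [← D.app_zero]
    congr 1
    ext x
    linear_combination h x
  have h2 : IsC0 (fun x => a x + a x * b x) := by
    refine ⟨by have := ha.continuous; have := hb.continuous; fun_prop, ?_⟩
    simpa using ha.zero_at_infty.add (ha.mul hb).zero_at_infty
  rw [app, funCalc_add _ h2 hb, funCalc_add _ ha (ha.mul hb), funCalc_mul _ ha hb] at h1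
  rw [add_mul, mul_add, mul_add, one_mul, mul_one, one_mul, add_assoc 1, add_eq_left]
  rw [← h1]
  simp only [app]
  abel

end AffiliatedSA

theorem mem_ASF_iff {D : AffiliatedSA N} {F : H →L[ℂ] H}
    (hF : IsBoundedTransform D.1 D.isSelfAdjoint F) (hFN : F ∈ N) :
    D ∈ ASF N τ ↔ IsUnit (calkinProj N τ ⟨F, hFN⟩) := by
  constructor
  · rintro ⟨G, hG, hu⟩
    convert hu
    ext x
    exact snd_eq_of_mem_graph (hF x) (hG x)
  · exact fun h => ⟨⟨F, hFN⟩, hF, h⟩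

theorem mul_self_boundedTransform {D : AffiliatedSA N} {F : H →L[ℂ] H}
    (hF : IsBoundedTransform D.1 D.isSelfAdjoint F) :
    F * F = 1 - D.app (fun t => (1 + t ^ 2)⁻¹) := by
  rw [hF.mul_self, ← funCalc_inv_one_add_sq]
  rfl

/-- Modulo `K(N)`, `F² = 1 - (1 + D²)⁻¹` equals `F² + φ_n(D)²`. The function behind the latter is
positive and tends to 1 at infinity, so it has an inverse of the same kind. Thus `π(F)²` is a unit,
hence so is `π(F)`. -/
theorem mem_ASF_of_memCompactIdeal {φ : ℝ → ℝ} (hφ : IsBump φ) {D : AffiliatedSA N} {n : ℕ+}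
    (h : MemCompactIdeal N τ (D.app (fun x => φ ((n : ℝ) * x)))) : D ∈ ASF N τ := by
  obtain ⟨F, hFN, hF⟩ := D.exists_boundedTransform
  rw [mem_ASF_iff hF hFN]
  set f : ℝ → ℝ := fun x => φ ((n : ℝ) * x) with hf
  have hfC : IsC0 f := hφ.isC0 n
  let a : ℝ → ℝ := fun x => f x * f x - (1 + x ^ 2)⁻¹
  have haC : IsC0 a := (hfC.mul hfC).sub isC0_inv_one_add_sq
  have hpos : ∀ x, 0 < 1 + a x := by
    intro x
    rcases eq_or_ne x 0 with rfl | hx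
    · have : 0 < f 0 := by simpa [hf] using hφ.pos (x := 0) (by simp)
      simp only [a]
      norm_num
      positivity
    · have h1 : (1 + x ^ 2)⁻¹ < 1 := inv_lt_one_of_one_lt₀ (by have := sq_pos_of_ne_zero hx; linarith)
      have h2 := mul_self_nonneg (f x)
      simp only [a]
      linarith
  let b : ℝ → ℝ := fun x => (1 + a x)⁻¹ - 1
  have hbC : IsC0 b := by
    refine ⟨((continuous_const.add haC.continuous).inv₀ fun x => (hpos x).ne').sub
      continuous_const, ?_⟩
    have := ((haC.zero_at_infty.const_add 1).inv₀ (by norm_num)).sub_const 1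
    simpa using this
  have hab : ∀ x, (1 + a x) * (1 + b x) = 1 := fun x => by
    have := (hpos x).ne'
    simp only [b]
    field_simp
    ring
  have h1 := D.one_add_app_mul_eq_one haC hbC hab
  have h2 := D.one_add_app_mul_eq_one hbC haC fun x => by rw [mul_comm, hab]
  let A : N := ⟨1 + D.app a, add_mem (one_mem _) (D.app_mem a)⟩
  let B : N := ⟨1 + D.app b, add_mem (one_mem _) (D.app_mem b)⟩
  have hAB : A * B = 1 := Subtype.ext h1
  have hBA : B * A = 1 := Subtype.ext h2
  have hA : IsUnit A := ⟨⟨A, B, hAB, hBA⟩, rfl⟩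
  have key : calkinProj N τ ⟨F, hFN⟩ * calkinProj N τ ⟨F, hFN⟩ = calkinProj N τ A := by
    rw [← map_mul, calkinProj_eq_iff]
    obtain ⟨K, hK, hK'⟩ := (h.mul_left (D.app_mem f)).neg
    convert hK
    refine Subtype.ext ?_
    rw [hK']
    show F * F - (1 + D.app a) = _
    rw [mul_self_boundedTransform hF]
    simp only [AffiliatedSA.app, a]
    rw [funCalc_sub _ (hfC.mul hfC) isC0_inv_one_add_sq, funCalc_mul _ hfC hfC]
    abel
  have hu := hA.map (calkinProj N τ)
  rw [← key] at hu
  exact ((Commute.refl _).isUnit_mul_iff.1 hu).1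

/-- If `T F² ≡ 1` modulo `K(N)`, then `φ_m(D) ≡ T F² φ_m(D)`. On the support of `φ_m` the function
`x²/(1 + x²)` of `F²` is at most `m⁻²`, so for large `m` this reads `(1 - small) φ_m(D) ∈ K(N)`. -/
theorem exists_memCompactIdeal_of_mem_ASF {φ : ℝ → ℝ} (hφ : IsBump φ) {D : AffiliatedSA N}
    (h : D ∈ ASF N τ) (n : ℕ+) :
    ∃ m ≥ n, MemCompactIdeal N τ (D.app (fun x => φ ((m : ℝ) * x))) := by
  obtain ⟨F, hFN, hF⟩ := D.exists_boundedTransform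
  rw [mem_ASF_iff hF hFN] at h
  obtain ⟨v, hv⟩ := h.exists_left_inv
  obtain ⟨S, rfl⟩ : ∃ S, calkinProj N τ S = v := (compactIdeal N τ).ringCon.mk'_surjective v
  have hS : MemCompactIdeal N τ ((S : H →L[ℂ] H) * S * (F * F) - 1) := by
    have h1 : calkinProj N τ (S * S * (⟨F, hFN⟩ * ⟨F, hFN⟩)) = calkinProj N τ 1 := by
      simp only [map_mul, map_one]
      rw [mul_assoc, ← mul_assoc (calkinProj N τ S) (calkinProj N τ ⟨F, hFN⟩), hv, one_mul, hv]
    rw [calkinProj_eq_iff] at h1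
    exact ⟨_, h1, rfl⟩
  set T : H →L[ℂ] H := (S : H →L[ℂ] H) * S with hT
  have hTN : T ∈ N := mul_mem S.2 S.2
  obtain ⟨k, hk⟩ := exists_nat_gt ‖T‖
  have hkpos : 0 < k := by
    have := (norm_nonneg T).trans_lt hk
    exact_mod_cast this
  let m : ℕ+ := n * ⟨k, hkpos⟩
  have hmn : n ≤ m := le_mul_of_one_le_right' one_le
  have hmk : (k : ℝ) ≤ m := by
    have : k ≤ (m : ℕ) := by
      exact Nat.le_mul_of_pos_left _ n.pos
    exact_mod_cast this
  have hm1 : (1 : ℝ) ≤ m := by exact_mod_cast m.pos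
  refine ⟨m, hmn, ?_⟩
  set f : ℝ → ℝ := fun x => φ ((m : ℝ) * x) with hf
  have hfC : IsC0 f := hφ.isC0 m
  let δ : ℝ := ((m : ℝ) ^ 2)⁻¹
  have hδ : 0 < δ := by positivity
  -- Truncating at `δ` leaves `x²/(1 + x²)` unchanged where `φ_m ≠ 0`, and makes it small and
  -- vanishing at infinity.
  let y : ℝ → ℝ := fun x => min (x ^ 2) δ * (1 + x ^ 2)⁻¹
  have hy0 : ∀ x, |y x| ≤ δ * (1 + x ^ 2)⁻¹ := fun x => by
    have h1 : 0 ≤ min (x ^ 2) δ := le_min (sq_nonneg _) hδ.le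
    rw [abs_of_nonneg (by positivity)]
    exact mul_le_mul_of_nonneg_right (min_le_right _ _) (by positivity)
  have hyδ : ∀ x, |y x| ≤ δ := fun x => by
    refine (hy0 x).trans (mul_le_of_le_one_right hδ.le (inv_le_one_of_one_le₀ ?_))
    nlinarith [sq_nonneg x]
  have hyC : IsC0 y := by
    refine IsC0.of_abs_le (g := fun x => δ * (1 + x ^ 2)⁻¹)
      ⟨continuous_const.mul isC0_inv_one_add_sq.continuous, ?_⟩
      (Continuous.mul (by fun_prop) isC0_inv_one_add_sq.continuous) hy0
    simpa using isC0_inv_one_add_sq.zero_at_infty.const_mul δ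
  have hyf : (fun x => y x * f x) = fun x => f x - (1 + x ^ 2)⁻¹ * f x := by
    ext x
    rcases lt_or_ge |(m : ℝ) * x| 1 with hx | hx
    · have h1 : x ^ 2 ≤ δ := by
        have h2 : ((m : ℝ) * x) ^ 2 ≤ 1 := (sq_le_one_iff_abs_le_one _).2 hx.le
        rw [mul_pow] at h2
        simp only [δ]
        rw [← one_div, le_div_iff₀ (by positivity)]
        linarith
      simp only [y, min_eq_left h1]
      have : (1 + x ^ 2) ≠ 0 := by positivity
      field_simp
      ring
    · simp [hf, hφ.eq_zero hx]
  have hnorm : ‖T * D.app y‖ < 1 := by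
    have h1 : ‖D.app y‖ ≤ δ := norm_funCalc_le _ hδ.le hyδ
    have h2 : ‖T‖ < (m : ℝ) ^ 2 := by nlinarith
    calc ‖T * D.app y‖ ≤ ‖T‖ * ‖D.app y‖ := norm_mul_le _ _
      _ ≤ ‖T‖ * δ := by gcongr
      _ < (m : ℝ) ^ 2 * δ := by gcongr
      _ = 1 := mul_inv_cancel₀ (by positivity)
  refine MemCompactIdeal.of_one_sub_mul (mul_mem hTN (D.app_mem y)) hnorm ?_
  have h3 := (hS.neg).mul_right (D.app_mem f)
  convert h3 using 1
  have h4 : D.app y * D.app f = D.app f - D.app (fun t => (1 + t ^ 2)⁻¹) * D.app f := by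
    simp only [AffiliatedSA.app]
    rw [← funCalc_mul _ hyC hfC, hyf, funCalc_sub _ hfC (isC0_inv_one_add_sq.mul hfC),
      funCalc_mul _ isC0_inv_one_add_sq hfC]
  rw [mul_self_boundedTransform hF, sub_mul, mul_assoc, h4]
  noncomm_ring

/-- With `q = 1/f` on the set `g ≠ 0` and `|q| ≤ 1/ε`, one has `q f g = g`, so `(1 - q(D)(f(D) - K))
g(D) = q(D) K g(D)` lies in the ideal and the left factor is invertible. -/
theorem memCompactIdeal_of_norm_sub_lt {D : AffiliatedSA N} {K : H →L[ℂ] H}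
    (hK : MemCompactIdeal N τ K) {f g : ℝ → ℝ} (hf : IsC0 f) (hg : IsC0 g) {ε : ℝ} (hε : 0 < ε)
    (hf0 : ∀ x, 0 ≤ f x) (hfg : ∀ x, g x ≠ 0 → ε ≤ f x) (h : ‖D.app f - K‖ < ε) :
    MemCompactIdeal N τ (D.app g) := by
  let q : ℝ → ℝ := fun x => min (f x / ε) 1 / max (f x) ε
  have hmax : ∀ x, 0 < max (f x) ε := fun x => lt_max_of_lt_right hε
  have hmin : ∀ x, 0 ≤ min (f x / ε) 1 := fun x => le_min (div_nonneg (hf0 x) hε.le) zero_le_one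
  have hq1 : ∀ x, |q x| ≤ ε⁻¹ := fun x => by
    rw [abs_of_nonneg (div_nonneg (hmin x) (hmax x).le), ← one_div]
    exact div_le_div₀ zero_le_one (min_le_right _ _) hε (le_max_right _ _)
  have hqC : IsC0 q := by
    have hc := hf.continuous
    refine IsC0.of_abs_le (g := fun x => (f x / ε) / ε) ⟨by fun_prop, ?_⟩ ?_ fun x => ?_
    · simpa using (hf.zero_at_infty.div_const ε).div_const ε
    · exact Continuous.div (by fun_prop) (by fun_prop) fun x => (hmax x).ne'
    · rw [abs_of_nonneg (div_nonneg (hmin x) (hmax x).le)]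
      exact div_le_div₀ (div_nonneg (hf0 x) hε.le) (min_le_left _ _) hε (le_max_right _ _)
  have hqfg : (fun x => q x * f x * g x) = g := by
    ext x
    by_cases hx : g x = 0
    · simp [hx]
    · have h1 := hfg x hx
      have h2 : 1 ≤ f x / ε := (one_le_div hε).2 h1
      have h3 : f x ≠ 0 := (hε.trans_le h1).ne'
      simp only [q, min_eq_right h2, max_eq_left h1]
      field_simp
  have hnorm : ‖D.app q * (D.app f - K)‖ < 1 := by
    calc ‖D.app q * (D.app f - K)‖ ≤ ‖D.app q‖ * ‖D.app f - K‖ := norm_mul_le _ _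
      _ ≤ ε⁻¹ * ‖D.app f - K‖ := by
        gcongr
        exact norm_funCalc_le _ (inv_nonneg.2 hε.le) hq1
      _ < ε⁻¹ * ε := by gcongr
      _ = 1 := inv_mul_cancel₀ hε.ne'
  refine MemCompactIdeal.of_one_sub_mul
    (mul_mem (D.app_mem q) (sub_mem (D.app_mem f) hK.mem)) hnorm ?_
  convert (hK.mul_left (D.app_mem q)).mul_right (D.app_mem g) using 1
  have h4 : D.app q * D.app f * D.app g = D.app g := by
    simp only [AffiliatedSA.app]
    rw [← funCalc_mul _ hqC hf, ← funCalc_mul _ (hqC.mul hf) hg, hqfg]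
  rw [sub_mul, mul_sub, sub_mul, h4, one_mul, sub_sub_cancel]

theorem mem_ASFn_of_norm_sub_lt {φ : ℝ → ℝ} (hφ : IsBump φ) {D : AffiliatedSA N}
    {K : H →L[ℂ] H} (hK : MemCompactIdeal N τ K) {m : ℕ+}
    (h : ‖D.app (fun x => φ ((m : ℝ) * x)) - K‖ < φ (1 / 2)) : D ∈ ASFn N τ φ (2 * m) := by
  have h1 : MemCompactIdeal N τ (D.app (fun x => φ (((2 * m : ℕ+) : ℝ) * x))) := by
    -- Where `φ_{2m} ≠ 0` one has `|m x| < 1/2`, hence `φ_m ≥ φ(1/2)`.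
    refine memCompactIdeal_of_norm_sub_lt hK (hφ.isC0 m) (hφ.isC0 (2 * m))
      (hφ.pos (by norm_num [abs_of_pos])) (fun x => hφ.nonneg _) (fun x hx => ?_) h
    have h2 : |(((2 * m : ℕ+) : ℝ) * x)| < 1 := by
      by_contra h3
      exact hx (hφ.eq_zero (not_lt.1 h3))
    have h3 : ((2 * m : ℕ+) : ℝ) = 2 * m := by push_cast; rfl
    rw [h3, mul_assoc, abs_mul, abs_two] at h2
    have h4 : |(1 / 2 : ℝ)| = 1 / 2 := by norm_num [abs_of_pos]
    refine hφ.apply_le ?_ ?_ <;> rw [h4] <;> linarith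
  exact ⟨mem_ASF_of_memCompactIdeal hφ h1, h1⟩

end CompactIdeal

/-! ### Resolvents of bounded selfadjoint operators. -/

section SelfAdjointShift

variable {H : Type*} [NormedAddCommGroup H] [InnerProductSpace ℂ H] [CompleteSpace H]
  {T : H →L[ℂ] H} {c : ℂ}

theorem add_ne_zero_of_mem_spectrum (hT : IsSelfAdjoint T) (hc : c.im ≠ 0) {z : ℂ}
    (hz : z ∈ spectrum ℂ T) : z + c ≠ 0 := fun h => hc <| by
  have := congrArg Complex.im h
  rwa [Complex.add_im, hT.im_eq_zero_of_mem_spectrum hz, zero_add] at this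

theorem add_smul_one_eq_cfc (hT : IsSelfAdjoint T) :
    T + c • (1 : H →L[ℂ] H) = cfc (fun z : ℂ => z + c) T := by
  rw [cfc_add_const c (fun z => z) T (by fun_prop) hT.isStarNormal,
    cfc_id' ℂ T hT.isStarNormal, Algebra.algebraMap_eq_smul_one]

theorem isUnit_add_smul_one (hT : IsSelfAdjoint T) (hc : c.im ≠ 0) :
    IsUnit (T + c • (1 : H →L[ℂ] H)) := by
  rw [add_smul_one_eq_cfc hT, isUnit_cfc_iff _ _ (by fun_prop) hT.isStarNormal]
  exact fun z hz => add_ne_zero_of_mem_spectrum hT hc hz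

theorem norm_inverse_add_smul_one_le (hT : IsSelfAdjoint T) (hc : c.im ≠ 0) :
    ‖Ring.inverse (T + c • (1 : H →L[ℂ] H))‖ ≤ |c.im|⁻¹ := by
  rw [add_smul_one_eq_cfc hT, ← cfc_inv (fun z : ℂ => z + c) T
    (fun z hz => add_ne_zero_of_mem_spectrum hT hc hz) (by fun_prop) hT.isStarNormal]
  refine norm_cfc_le (by positivity) fun z hz => ?_
  rw [norm_inv]
  refine inv_anti₀ (by positivity) ?_
  have h := Complex.abs_im_le_norm (z + c)
  rwa [Complex.add_im, hT.im_eq_zero_of_mem_spectrum hz, zero_add] at h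

theorem inverse_add_smul_one_mem {N : VonNeumannAlgebra H} (hTN : T ∈ N) :
    Ring.inverse (T + c • (1 : H →L[ℂ] H)) ∈ N := by
  by_cases h : IsUnit (T + c • (1 : H →L[ℂ] H))
  · refine mem_of_forall_commute fun S hS => ?_
    have h1 : Commute (T + c • (1 : H →L[ℂ] H)) S :=
      (hS T hTN).add_left ((Commute.one_left S).smul_left c)
    obtain ⟨u, hu⟩ := h
    rw [← hu] at h1 ⊢
    rw [Ring.inverse_unit]
    exact h1.units_inv_left
  · rw [Ring.inverse_non_unit _ h]
    exact zero_mem _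

theorem add_smul_one_mem {N : VonNeumannAlgebra H} (hTN : T ∈ N) :
    T + c • (1 : H →L[ℂ] H) ∈ N :=
  mem_of_forall_commute fun S hS => (hS T hTN).add_left ((Commute.one_left S).smul_left c)

end SelfAdjointShift

/-! ### Continuity after multiplication by elements of `K(N)`. -/

section StrictContinuity

theorem continuousAt_of_norm_sub_le {X E F : Type*} [TopologicalSpace X] [SeminormedAddCommGroup E]
    [SeminormedAddCommGroup F] {f : X → E} {g : X → F} {x : X} (C : ℝ) (hg : ContinuousAt g x)
    (h : ∀ y, ‖f y - f x‖ ≤ C * ‖g y - g x‖) : ContinuousAt f x := by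
  rw [ContinuousAt, tendsto_iff_norm_sub_tendsto_zero] at hg ⊢
  refine squeeze_zero (fun _ => norm_nonneg _) h ?_
  simpa using hg.const_mul C

variable {H : Type*} [NormedAddCommGroup H] [InnerProductSpace ℂ H] [CompleteSpace H]
  {N : VonNeumannAlgebra H} {τ : (H →L[ℂ] H) → ℝ≥0∞} {X : Type*} [TopologicalSpace X]
  {S T : X → H →L[ℂ] H}

/-- The maps `x ↦ T x * K` are norm continuous for all `K ∈ K(N)`. -/
def StrictContinuous (N : VonNeumannAlgebra H) (τ : (H →L[ℂ] H) → ℝ≥0∞) (T : X → H →L[ℂ] H) :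
    Prop :=
  ∀ K, MemCompactIdeal N τ K → Continuous fun x => T x * K

/-- At a base point `x` the hypothesis is applied to `(T x + c) K`, again in the ideal; the factor
`T y + c` left over is uniformly bounded. -/
theorem StrictContinuous.of_inverse {c : ℂ} (hc : c.im ≠ 0) (hTN : ∀ x, T x ∈ N)
    (hT : ∀ x, IsSelfAdjoint (T x)) (hT1 : ∀ x, ‖T x‖ ≤ 1)
    (h : StrictContinuous N τ fun x => Ring.inverse (T x + c • (1 : H →L[ℂ] H))) :
    StrictContinuous N τ T := by
  intro K hK
  rw [continuous_iff_continuousAt]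
  intro x
  have h1 := (h _ (hK.mul_left (add_smul_one_mem (c := c) (hTN x)))).continuousAt (x := x)
  refine continuousAt_of_norm_sub_le (1 + ‖c‖) h1 fun y => ?_
  have hx := isUnit_add_smul_one (hT x) hc
  have hy := isUnit_add_smul_one (hT y) hc
  have h2 : T y * K - T x * K = -((T y + c • (1 : H →L[ℂ] H)) *
      (Ring.inverse (T y + c • (1 : H →L[ℂ] H)) * ((T x + c • (1 : H →L[ℂ] H)) * K)
        - Ring.inverse (T x + c • (1 : H →L[ℂ] H)) * ((T x + c • (1 : H →L[ℂ] H)) * K))) := by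
    rw [Ring.inverse_mul_cancel_left _ _ hx, mul_sub, Ring.mul_inverse_cancel_left _ _ hy,
      add_mul, add_mul]
    abel
  rw [h2, norm_neg]
  refine (norm_mul_le _ _).trans (mul_le_mul_of_nonneg_right ?_ (norm_nonneg _))
  refine (norm_add_le _ _).trans (add_le_add (hT1 y) ?_)
  rw [norm_smul]
  exact mul_le_of_le_one_right (norm_nonneg _) ContinuousLinearMap.norm_id_le

theorem StrictContinuous.inverse {c : ℂ} (hc : c.im ≠ 0) (hTN : ∀ x, T x ∈ N)
    (hT : ∀ x, IsSelfAdjoint (T x)) (h : StrictContinuous N τ T) :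
    StrictContinuous N τ fun x => Ring.inverse (T x + c • (1 : H →L[ℂ] H)) := by
  intro K hK
  rw [continuous_iff_continuousAt]
  intro x
  have h1 := (h _ (hK.mul_left (inverse_add_smul_one_mem (c := c) (hTN x)))).continuousAt (x := x)
  refine continuousAt_of_norm_sub_le |c.im|⁻¹ h1 fun y => ?_
  have hx := isUnit_add_smul_one (hT x) hc
  have hy := isUnit_add_smul_one (hT y) hc
  have h2 : Ring.inverse (T y + c • (1 : H →L[ℂ] H)) * K
      - Ring.inverse (T x + c • (1 : H →L[ℂ] H)) * K
      = -(Ring.inverse (T y + c • (1 : H →L[ℂ] H)) *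
        (T y * (Ring.inverse (T x + c • (1 : H →L[ℂ] H)) * K)
          - T x * (Ring.inverse (T x + c • (1 : H →L[ℂ] H)) * K))) := by
    have h3 : T y * (Ring.inverse (T x + c • (1 : H →L[ℂ] H)) * K)
          - T x * (Ring.inverse (T x + c • (1 : H →L[ℂ] H)) * K)
        = (T y + c • (1 : H →L[ℂ] H)) * (Ring.inverse (T x + c • (1 : H →L[ℂ] H)) * K)
          - (T x + c • (1 : H →L[ℂ] H)) * (Ring.inverse (T x + c • (1 : H →L[ℂ] H)) * K) := by
      rw [add_mul, add_mul]
      abel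
    rw [h3, Ring.mul_inverse_cancel_left _ _ hx, mul_sub, Ring.inverse_mul_cancel_left _ _ hy]
    abel
  rw [h2, norm_neg]
  exact (norm_mul_le _ _).trans
    (mul_le_mul_of_nonneg_right (norm_inverse_add_smul_one_le (hT y) hc) (norm_nonneg _))

theorem StrictContinuous.mul (hS : StrictContinuous N τ S) (hT : StrictContinuous N τ T)
    (hTN : ∀ x, T x ∈ N) (C : ℝ) (hC : ∀ x, ‖S x‖ ≤ C) :
    StrictContinuous N τ fun x => S x * T x := by
  intro K hK
  rw [continuous_iff_continuousAt]
  intro x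
  have h1 := (hS _ (hK.mul_left (hTN x))).continuousAt (x := x)
  have h2 : ContinuousAt (fun y => S y * (T y * K - T x * K)) x := by
    refine continuousAt_of_norm_sub_le C ((hT K hK).continuousAt (x := x)) fun y => ?_
    rw [sub_self, mul_zero, sub_zero]
    exact (norm_mul_le _ _).trans (mul_le_mul_of_nonneg_right (hC y) (norm_nonneg _))
  refine (h2.add h1).congr (Filter.Eventually.of_forall fun y => ?_)
  simp only [Pi.add_apply, mul_sub, mul_assoc, sub_add_cancel]

theorem StrictContinuous.pow (hT : StrictContinuous N τ T) (hTN : ∀ x, T x ∈ N)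
    (hT1 : ∀ x, ‖T x‖ ≤ 1) (n : ℕ) : StrictContinuous N τ fun x => T x ^ n := by
  induction n with
  | zero => exact fun K _ => by simpa using continuous_const
  | succ n ih =>
    simp_rw [pow_succ']
    exact hT.mul ih (fun x => pow_mem (hTN x) n) 1 hT1

theorem StrictContinuous.aeval (hT : StrictContinuous N τ T) (hTN : ∀ x, T x ∈ N)
    (hT1 : ∀ x, ‖T x‖ ≤ 1) (p : Polynomial ℝ) :
    StrictContinuous N τ fun x => Polynomial.aeval (T x) p := by
  intro K hK
  induction p using Polynomial.induction_on' with
  | add p q hp hq =>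
    simp only [map_add, add_mul]
    exact hp.add hq
  | monomial n a =>
    simp only [Polynomial.aeval_monomial, Algebra.algebraMap_eq_smul_one, smul_mul_assoc, one_mul]
    exact (hT.pow hTN hT1 n K hK).const_smul a

/-- Weierstrass approximation on `[-1, 1]`, which contains all the spectra: the polynomial case
passes to the uniform limit. -/
theorem StrictContinuous.cfc (hT : StrictContinuous N τ T) (hTN : ∀ x, T x ∈ N)
    (hTsa : ∀ x, IsSelfAdjoint (T x)) (hT1 : ∀ x, ‖T x‖ ≤ 1) {g : ℝ → ℝ} (hg : Continuous g) :
    StrictContinuous N τ fun x => _root_.cfc g (T x) := by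
  intro K hK
  refine continuous_of_uniform_approx_of_continuous ?_
  rw [Metric.uniformity_basis_dist_le.forall_iff (by
    intro s t hst h
    obtain ⟨F, hF, hF'⟩ := h
    exact ⟨F, hF, fun y => hst (hF' y)⟩)]
  intro ε hε
  obtain ⟨p, hp⟩ := exists_polynomial_near_of_continuousOn (-1) 1 g hg.continuousOn
    (ε / (‖K‖ + 1)) (by positivity)
  refine ⟨_, hT.aeval hTN hT1 p K hK, fun x => ?_⟩
  simp only [Set.mem_ofPred_eq, dist_eq_norm]
  have h1 : ‖_root_.cfc g (T x) - Polynomial.aeval (T x) p‖ ≤ ε / (‖K‖ + 1) := by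
    rw [← cfc_polynomial p (T x) (hTsa x), ← cfc_sub g p.eval (T x) hg.continuousOn
      p.continuous.continuousOn]
    refine norm_cfc_le (by positivity) fun t ht => ?_
    have h2 : |t| ≤ 1 := by
      have h3 := spectrum.norm_le_norm_mul_of_mem ht
      have h4 : ‖(1 : H →L[ℂ] H)‖ ≤ 1 := ContinuousLinearMap.norm_id_le
      rw [Real.norm_eq_abs] at h3
      nlinarith [hT1 x, norm_nonneg (T x), norm_nonneg (1 : H →L[ℂ] H)]
    rw [Real.norm_eq_abs, abs_sub_comm]
    exact (hp t (abs_le.1 h2)).le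
  rw [← sub_mul]
  calc ‖(_root_.cfc g (T x) - Polynomial.aeval (T x) p) * K‖
      ≤ ‖_root_.cfc g (T x) - Polynomial.aeval (T x) p‖ * ‖K‖ := norm_mul_le _ _
    _ ≤ ε / (‖K‖ + 1) * (‖K‖ + 1) := by gcongr; linarith
    _ = ε := div_mul_cancel₀ _ (by positivity)

end StrictContinuity

/-! ### Writing `φ_m` and `ψ_m` through `φ_n` and `ψ_n`. -/

section Truncation

variable {φ : ℝ → ℝ} {ψ : ℕ+ → ℝ → ℝ}

/-- `φ` embeds `[-1, 0]` as a closed set, so Tietze extends `φ(x) ↦ φ(r x)` to the line. Evenness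
covers `x > 0`, and `r ≥ 1` makes `φ(r x)` vanish wherever `φ(x)` does. -/
theorem IsBump.exists_comp (hφ : IsBump φ) {r : ℝ} (hr : 1 ≤ r) :
    ∃ g : ℝ → ℝ, Continuous g ∧ g 0 = 0 ∧ ∀ x, φ (r * x) = g (φ x) := by
  have hc := hφ.smooth.continuous
  have he : IsClosedEmbedding (fun x : Set.Icc (-1 : ℝ) 0 => φ x) := by
    refine Continuous.isClosedEmbedding (by fun_prop) ?_
    intro x y hxy
    exact Subtype.ext (hφ.strictMonoOn.injOn x.2 y.2 hxy)
  obtain ⟨g, hg⟩ := ContinuousMap.exists_extension' he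
    ⟨fun x : Set.Icc (-1 : ℝ) 0 => φ (r * x), by fun_prop⟩
  have hg' : ∀ x ∈ Set.Icc (-1 : ℝ) 0, g (φ x) = φ (r * x) := fun x hx => congrFun hg ⟨x, hx⟩
  have h1 : φ (-1) = 0 := hφ.eq_zero (by simp)
  have hg0 : g 0 = 0 := by
    have := hg' (-1) ⟨le_rfl, by norm_num⟩
    rw [h1] at this
    rw [this]
    refine hφ.eq_zero ?_
    rw [abs_mul, abs_neg, abs_one, mul_one]
    exact hr.trans (le_abs_self r)
  refine ⟨g, g.continuous, hg0, fun x => ?_⟩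
  rcases lt_or_ge |x| 1 with hx | hx
  · rw [← hφ.apply_neg_abs x, hg' _ ⟨by linarith, by linarith [abs_nonneg x]⟩, mul_neg, hφ.even,
      ← hφ.apply_neg_abs (r * |x|), ← hφ.apply_neg_abs (r * x)]
    simp [abs_mul]
  · rw [hφ.eq_zero hx, hg0]
    refine hφ.eq_zero ?_
    rw [abs_mul]
    nlinarith [le_abs_self r, abs_nonneg x]

theorem IsTruncation.isC0 (hψ : IsTruncation ψ) (n : ℕ+) : IsC0 (ψ n) := by
  refine ⟨hψ.continuous n, ?_⟩
  rcases eq_or_ne n 1 with rfl | hn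
  · exact hψ.zero_at_infty
  · exact (hψ.hasCompactSupport n (lt_of_le_of_ne one_le hn.symm)).is_zero_at_infty

theorem IsTruncation.apply_zero (hψ : IsTruncation ψ) (n : ℕ+) : ψ n 0 = 0 := by
  have h := hψ.odd n 0
  rw [neg_zero] at h
  linarith

theorem IsTruncation.exists_factorization (hφ : IsBump φ) (hψ : IsTruncation ψ) {n m : ℕ+}
    (h : n < m) : ∃ g : ℝ → ℝ, Continuous g ∧ g 0 = 0 ∧
      ∀ x, ψ m x = g (φ ((n : ℝ) * x)) * ψ m (ψ n x) := by
  have hm : 1 < m := one_le.trans_lt h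
  have hn0 : (0 : ℝ) < n := by exact_mod_cast n.pos
  have hnm : (n : ℝ) ≤ m - 1 := by
    have : (n : ℕ) + 1 ≤ m := h
    have : (n : ℝ) + 1 ≤ m := by exact_mod_cast this
    linarith
  have hsupp : ∀ x ∈ tsupport (ψ m), |x| < 1 / (n : ℝ) := fun x hx => by
    have h1 := hψ.tsupport_subset m hm hx
    exact (abs_lt.2 h1).trans_le (one_div_le_one_div_of_le hn0 hnm)
  have hpos : ∀ x ∈ tsupport (ψ m), 0 < φ ((n : ℝ) * x) := fun x hx => by
    refine hφ.pos ?_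
    rw [abs_natCast_mul]
    have := (lt_div_iff₀ hn0).1 (hsupp x hx)
    linarith
  have hne : (tsupport (ψ m)).Nonempty := by
    refine ⟨1 / (m : ℝ), subset_tsupport _ ?_⟩
    have hm0 : (0 : ℝ) < m := by exact_mod_cast m.pos
    have h0 : 0 < 1 / (m : ℝ) := by positivity
    rw [Function.mem_support, hψ.eq_self m _ ⟨by linarith, le_rfl⟩]
    exact h0.ne'
  -- The minimum `c > 0` of `φ_n` on the compact support of `ψ_m` makes `min(φ_n/c, 1)` equal to 1
  -- there. It is 0 for `|x| > 1/n`, where `ψ_m(ψ_n(x))` is uncontrolled.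
  obtain ⟨x₀, hx₀, hmin⟩ := (hψ.hasCompactSupport m hm).isCompact.exists_isMinOn hne
    (hφ.isC0 n).continuous.continuousOn
  have hc := hpos x₀ hx₀
  set c := φ ((n : ℝ) * x₀)
  refine ⟨fun s => min (s / c) 1, by fun_prop, by simp, fun x => ?_⟩
  by_cases hx : x ∈ tsupport (ψ m)
  · have h1 : 1 ≤ φ ((n : ℝ) * x) / c := (one_le_div hc).2 (hmin hx)
    have h2 := abs_le.1 (hsupp x hx).le
    rw [hψ.eq_self n x h2]
    simp only [min_eq_right h1, one_mul]
  · have h0 := image_eq_zero_of_notMem_tsupport hx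
    rcases le_or_gt |x| (1 / (n : ℝ)) with h1 | h1
    · rw [hψ.eq_self n x (abs_le.1 h1), h0, mul_zero]
    · have h2 : φ ((n : ℝ) * x) = 0 := by
        refine hφ.eq_zero ?_
        rw [abs_natCast_mul]
        have := (div_lt_iff₀ hn0).1 h1
        linarith
      simp [h0, h2]

end Truncation

/-! ### Comparison of the topologies. -/

section Topologies

variable {H : Type*} [NormedAddCommGroup H] [InnerProductSpace ℂ H] [CompleteSpace H]
  {N : VonNeumannAlgebra H} {τ : (H →L[ℂ] H) → ℝ≥0∞} {φ : ℝ → ℝ} {ψ : ℕ+ → ℝ → ℝ}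

theorem AffiliatedSA.isSelfAdjoint_app (D : AffiliatedSA N) (f : ℝ → ℝ) :
    IsSelfAdjoint (D.app f) := isSelfAdjoint_funCalc _ f

theorem AffiliatedSA.norm_app_le_one (hψ : IsTruncation ψ) (n : ℕ+) (D : AffiliatedSA N) :
    ‖D.app (ψ n)‖ ≤ 1 :=
  norm_funCalc_le _ zero_le_one fun x => abs_le.2 (hψ.mem_Icc n x)

theorem continuous_app_comp [TopologicalSpace (AffiliatedSA N)] {f g : ℝ → ℝ} (hf : IsC0 f)
    (hg : Continuous g) (hg0 : g 0 = 0) {a b : ℝ} (hab : ∀ x, f x ∈ Set.Icc a b)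
    (h0 : (0 : ℝ) ∈ Set.Icc a b) (h : Continuous fun D : AffiliatedSA N => D.app f) :
    Continuous fun D : AffiliatedSA N => D.app (fun x => g (f x)) := by
  have h1 : (fun D : AffiliatedSA N => D.app (fun x => g (f x)))
      = fun D => cfc g (D.app f) := funext fun D => funCalc_comp _ hf hg hg0
  rw [h1]
  exact h.cfc' isCompact_Icc g (fun D => spectrum_funCalc_subset _ hf h0 hab)
    (hf := hg.continuousOn) (ha' := fun D => D.isSelfAdjoint_app f)

theorem strictContinuous_inverse_of_asn (n : ℕ+) :
    letI := asnTopology N τ φ ψ n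
    StrictContinuous N τ fun D : AffiliatedSA N =>
      Ring.inverse (D.app (ψ n) + Complex.I • (1 : H →L[ℂ] H)) := by
  let := asnTopology N τ φ ψ n
  rintro _ ⟨K, hK, rfl⟩
  rw [continuous_iff_le_induced]
  exact (inf_le_left.trans inf_le_left).trans (iInf_le _ (⟨K, hK⟩ : compactIdeal N τ))

theorem continuous_app_of_asn (n : ℕ+) :
    Continuous[asnTopology N τ φ ψ n, inferInstance]
      (fun D : AffiliatedSA N => D.app (fun x => φ ((n : ℝ) * x))) := by
  rw [continuous_iff_le_induced]
  exact inf_le_right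

/-- Strict continuity of `ψ_n(D)` itself controls both families of resolvents, at `i` and at `-i`.
-/
theorem le_asnTopology (n : ℕ+) [t : TopologicalSpace (AffiliatedSA N)]
    (h1 : StrictContinuous N τ fun D : AffiliatedSA N => D.app (ψ n))
    (h2 : Continuous fun D : AffiliatedSA N => D.app (fun x => φ ((n : ℝ) * x))) :
    t ≤ asnTopology N τ φ ψ n := by
  refine le_inf (le_inf (le_iInf fun K => ?_) (le_iInf fun K => ?_)) ?_
  · rw [← continuous_iff_le_induced]
    exact h1.inverse (by simp) (fun D => D.app_mem _) (fun D => D.isSelfAdjoint_app _) _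
      ⟨K, K.2, rfl⟩
  · rw [← continuous_iff_le_induced]
    have := h1.inverse (c := -Complex.I) (by simp) (fun D => D.app_mem _)
      (fun D => D.isSelfAdjoint_app _) _ ⟨K, K.2, rfl⟩
    simpa only [neg_smul, ← sub_eq_add_neg] using this
  · rwa [← continuous_iff_le_induced]

theorem asnTopology_mono (hφ : IsBump φ) (hψ : IsTruncation ψ) {n m : ℕ+} (hnm : n ≤ m) :
    asnTopology N τ φ ψ n ≤ asnTopology N τ φ ψ m := by
  rcases hnm.eq_or_lt with rfl | hlt
  · exact le_rfl
  let := asnTopology N τ φ ψ n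
  have hφn : Continuous fun D : AffiliatedSA N => D.app (fun x => φ ((n : ℝ) * x)) :=
    continuous_app_of_asn n
  have hmem : ∀ x, φ ((n : ℝ) * x) ∈ Set.Icc 0 (φ 0) := fun x => by
    refine ⟨hφ.nonneg _, ?_⟩
    rcases le_or_gt |(n : ℝ) * x| 1 with h | h
    · exact hφ.apply_le (by simp) h
    · rw [hφ.eq_zero h.le]
      exact hφ.nonneg _
  have h0 : (0 : ℝ) ∈ Set.Icc 0 (φ 0) := ⟨le_rfl, hφ.nonneg _⟩
  have hψn : StrictContinuous N τ fun D : AffiliatedSA N => D.app (ψ n) :=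
    (strictContinuous_inverse_of_asn n).of_inverse (by simp) (fun D => D.app_mem _)
      (fun D => D.isSelfAdjoint_app _) (fun D => D.norm_app_le_one hψ n)
  refine le_asnTopology m ?_ ?_
  · obtain ⟨g, hg, hg0, hfac⟩ := hψ.exists_factorization hφ hlt
    have h1 := continuous_app_comp (hφ.isC0 n) hg hg0 hmem h0 hφn
    have h2 := hψn.cfc (fun D => D.app_mem _) (fun D => D.isSelfAdjoint_app _)
      (fun D => D.norm_app_le_one hψ n) (hψ.continuous m)
    intro K hK
    -- The factorization splits `ψ_m(D) K` into a norm continuous factor and a strictly continuous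
    -- one already multiplied by `K`.
    have h3 : (fun D : AffiliatedSA N => D.app (ψ m) * K)
        = fun D => D.app (fun x => g (φ ((n : ℝ) * x))) * (cfc (ψ m) (D.app (ψ n)) * K) := by
      ext1 D
      rw [← mul_assoc]
      congr 1
      simp only [AffiliatedSA.app]
      rw [← funCalc_comp _ (hψ.isC0 n) (hψ.continuous m) (hψ.apply_zero m),
        ← funCalc_mul _ ((hφ.isC0 n).comp hg hg0)
          ((hψ.isC0 n).comp (hψ.continuous m) (hψ.apply_zero m))]
      congr 1
      exact funext hfac
    rw [h3]
    exact h1.mul (h2 K hK)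
  · have hn0 : (0 : ℝ) < n := by exact_mod_cast n.pos
    have hr : (1 : ℝ) ≤ m / n := by
      rw [one_le_div hn0]
      exact_mod_cast hnm
    obtain ⟨g, hg, hg0, hcomp⟩ := hφ.exists_comp hr
    have h1 := continuous_app_comp (hφ.isC0 n) hg hg0 hmem h0 hφn
    convert h1 using 4 with D x
    rw [← hcomp]
    congr 1
    field_simp

/-- All spectra of the resolvents lie in one compact circle on which the function is continuous, so
the functional calculus depends continuously on the resolvent. -/
theorem continuous_app_gap {f : ℝ → ℝ} (hf : IsC0 f) :
    Continuous[gapTopology N, inferInstance] (fun D : AffiliatedSA N => D.app f) := by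
  let := gapTopology N
  have h : Continuous fun D : AffiliatedSA N => D.res := continuous_induced_dom
  exact h.cfc' isCompact_resolventCircle (circleFun f)
    (fun D => spectrum_resolventI_subset D.isSelfAdjoint)
    (hf := continuousOn_circleFun hf) (ha' := fun D => isStarNormal_resolventI D.isSelfAdjoint)

theorem gapTopology_le_asTopology (hφ : IsBump φ) (hψ : IsTruncation ψ) :
    gapTopology N ≤ asTopology N τ φ ψ := by
  refine le_trans ?_ (le_iSup (asnTopology N τ φ ψ) 1)
  let := gapTopology N
  exact le_asnTopology 1 (fun K _ => (continuous_app_gap (hψ.isC0 1)).mul continuous_const)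
    (continuous_app_gap (hφ.isC0 1))

theorem exists_eventually_mem_ASFn (hφ : IsBump φ) (hψ : IsTruncation ψ) {D : AffiliatedSA N}
    (hD : D ∈ ASF N τ) (n : ℕ+) :
    ∃ m ≥ n, ASFn N τ φ m ∈ @nhds _ (asnTopology N τ φ ψ n) D := by
  obtain ⟨m, hm, hK⟩ := exists_memCompactIdeal_of_mem_ASF hφ hD n
  refine ⟨2 * m, hm.trans (le_mul_of_one_le_left' one_le), ?_⟩
  let := asnTopology N τ φ ψ n
  have h1 : Continuous fun D : AffiliatedSA N => D.app (fun x => φ ((m : ℝ) * x)) :=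
    continuous_le_dom (asnTopology_mono hφ hψ hm) (continuous_app_of_asn m)
  have h2 : (0 : ℝ) < φ (1 / 2) := hφ.pos (by norm_num [abs_of_pos])
  filter_upwards [h1.continuousAt.eventually (Metric.ball_mem_nhds _ h2)] with D' hD'
  rw [dist_eq_norm] at hD'
  exact mem_ASFn_of_norm_sub_lt hφ hK hD'

theorem isOpen_ASF (hφ : IsBump φ) (hψ : IsTruncation ψ) :
    IsOpen[asTopology N τ φ ψ] (ASF N τ) := by
  refine isOpen_iSup_iff.2 fun n => ?_
  let := asnTopology N τ φ ψ n
  refine isOpen_iff_mem_nhds.2 fun D hD => ?_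
  obtain ⟨m, -, hm⟩ := exists_eventually_mem_ASFn hφ hψ hD n
  exact Filter.mem_of_superset hm fun _ h => h.1

theorem ASFlim_eq (hφ : IsBump φ) : ASFlim N τ φ = ASF N τ := by
  ext D
  refine ⟨fun h => ?_, fun h => ?_⟩
  · obtain ⟨n, hn⟩ := Set.mem_iUnion.1 h
    exact hn.1
  · obtain ⟨m, -, hm⟩ := exists_memCompactIdeal_of_mem_ASF hφ h 1
    exact Set.mem_iUnion.2 ⟨m, h, hm⟩

theorem isOpen_of_isOpen_asfTopology (hφ : IsBump φ) (hψ : IsTruncation ψ)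
    {W : Set (ASFlim N τ φ)} (hW : IsOpen[asfTopology N τ φ ψ] W) :
    IsOpen[asTopology N τ φ ψ] (Subtype.val '' W) := by
  refine isOpen_iSup_iff.2 fun n => ?_
  let := asnTopology N τ φ ψ n
  refine isOpen_iff_mem_nhds.2 ?_
  rintro _ ⟨D, hD, rfl⟩
  obtain ⟨m, hnm, hm⟩ := exists_eventually_mem_ASFn hφ hψ ((ASFlim_eq hφ).subset D.2) n
  have h1 := isOpen_iSup_iff.1 hW m
  obtain ⟨V, hV, hVW⟩ := (@isOpen_induced_iff _ _ (asnTopology N τ φ ψ m) _ _).1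
    ((@isOpen_coinduced _ _ _ _ _).1 h1)
  -- The choice `m ≥ n` matters here: a set open for `m` is open for the finer topology of index
  -- `n`.
  have hV' : IsOpen V := asnTopology_mono hφ hψ hnm V hV
  have hiff : ∀ D' (h : D' ∈ ASFn N τ φ m),
      D' ∈ V ↔ (⟨D', Set.subset_iUnion (ASFn N τ φ) m h⟩ : ASFlim N τ φ) ∈ W := fun D' h =>
    Set.ext_iff.1 hVW ⟨D', h⟩
  have hDV : (D : AffiliatedSA N) ∈ V := (hiff D (mem_of_mem_nhds hm)).2 hD
  filter_upwards [hm, hV'.mem_nhds hDV] with D' h h'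
  exact ⟨_, (hiff D' h).1 h', rfl⟩

end Topologies

end

end SpectralFlow


open SpectralFlow in
theorem proposition2p6 {H : Type*} [NormedAddCommGroup H] [InnerProductSpace ℂ H]
    [CompleteSpace H] (N : VonNeumannAlgebra H) (τ : (H →L[ℂ] H) → ℝ≥0∞)
    (hτ : IsFaithfulNormalSemifiniteTrace N τ)
    (φ : ℝ → ℝ) (hφ : IsBump φ) (ψ : ℕ+ → ℝ → ℝ) (hψ : IsTruncation ψ) :
    -- the identity is continuous from the gap topology to `𝔄𝔖(N)`
    Continuous[gapTopology N, asTopology N τ φ ψ] (fun D : AffiliatedSA N => D) ∧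
    -- `ASF(N)` is open in `𝔄𝔖(N)`
    IsOpen[asTopology N τ φ ψ] (ASF N τ) ∧
    -- the identity is a homeomorphism from `ASF(N)` with the subspace topology to `𝔄𝔖𝔉(N)`
    ∃ e : ASF N τ ≃ ASFlim N τ φ, (∀ D, (e D : AffiliatedSA N) = D) ∧
      Continuous[TopologicalSpace.induced Subtype.val (asTopology N τ φ ψ),
        asfTopology N τ φ ψ] e ∧
      Continuous[asfTopology N τ φ ψ,
        TopologicalSpace.induced Subtype.val (asTopology N τ φ ψ)] e.symm := by
  refine ⟨continuous_id_iff_le.2 (gapTopology_le_asTopology hφ hψ), isOpen_ASF hφ hψ,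
    Equiv.setCongr (ASFlim_eq hφ).symm, fun D => rfl, ?_, ?_⟩
  · refine continuous_def.2 fun W hW => ?_
    refine (@isOpen_induced_iff _ _ (asTopology N τ φ ψ) _ _).2 ⟨_, isOpen_of_isOpen_asfTopology hφ hψ hW, ?_⟩
    ext D
    constructor
    · rintro ⟨D', hD', h⟩
      have : D' = Equiv.setCongr (ASFlim_eq hφ).symm D := Subtype.ext h
      exact Set.mem_preimage.2 (this ▸ hD')
    · exact fun h => ⟨_, h, rfl⟩
  · rw [continuous_induced_rng]
    refine continuous_iSup_dom.2 fun n => continuous_coinduced_dom.2 ?_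
    exact continuous_le_rng (le_iSup (asnTopology N τ φ ψ) n) continuous_induced_dom
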